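/- Let $(M^{n+1},g)$ be a closed smooth Riemannian manifold, and let $W\colon\mathbb R\to\mathbb R$ be an even double-well potential: $W$ is smooth, non-negative and even, $W(\pm1)=0$ with $W''(\pm1)>0$, $W$ has a local maximum at $0$ with $W(0)>0$ and $W''(0)<0$, $W$ is increasing on $(-1,0)$ and $(1,\infty)$ and decreasing on $(0,1)$ and $(-\infty,-1)$, and there are $\kappa>0$, $\alpha\in(0,1)$ with $W''(x)\ge\kappa$ for $|x|\ge\alpha$. Put $\sigma=\int_{-1}^1\sqrt{W(s)/2}\,ds$ and, for $\varepsilon>0$ and $u\in W^{1,2}(M)$, $$E_\varepsilon(u)=\int_M \frac{\varepsilon}{2}|\nabla u|^2+\frac{W(u)}{\varepsilon}\in[0,\infty].$$ For a paracompact space $X$ with a free $\mathbb Z_2$-action, let $f\colon X/\mathbb Z_2\to\mathbb{RP}^\infty$ be a classifying map of the double cover $X\to X/\mathbb Z_2$ and let $\mu$ be the generator of $H^1(\mathbb{RP}^\infty;\mathbb Z_2)$. The index $\operatorname{ind}_{\mathbb Z_2}(X)$ is the largest $k\geq 1$ such that $f^*\mu^{k-1}\neq0$ in the Alexander–Spanier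 cohomology $H^*(X/\mathbb Z_2;\mathbb Z_2)$ (with value $0$ if there is no such $k$, and $\infty$ if there is no largest one). Let $\mathcal F_p$ be the family of compact sets $A\subset W^{1,2}(M)\setminus\{0\}$ that are invariant under $u\mapsto-u$ and satisfy $\operatorname{ind}_{\mathbb Z_2}(A)\ge p+1$, and let $\mathcal G_p$ be the family of those $A\in\mathcal F_p$ such that $\int_M u=0$ for every $u\in A$. Define $$c(\varepsilon,p)=\frac1{2\sigma}\inf_{A\in\mathcal F_p}\sup_{u\in A}E_\varepsilon(u),\qquad \tilde c(\varepsilon,p)=\frac1{2\sigma}\inf_{A\in\mathcal G_p}\sup_{u\in A}E_\varepsilon(u)$$ (with $\inf\emptyset=\infty$), and $$c(p)=\liminf_{\varepsilon\to0^+}c(\varepsilon,p),\qquad \tilde c(p)=\liminf_{\varepsilon\to0^+}\tilde c(\varepsilon,p).$$ Then $\tilde c(p)\le c(p+1)$ for all $p\in\mathbb N$. -/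

import Mathlib

open scoped Manifold ContDiff ENNReal Topology Bundle Matrix
open MeasureTheory Bundle

set_option linter.unusedSectionVars false

noncomputable section

namespace AlexanderSpanier

/-- Alexander-Spanier `n`-cochains with `ZMod 2` coefficients: arbitrary functions of `n + 1` points,
before dividing out the locally zero ones. -/
abbrev Cochain (X : Type*) (n : ℕ) : Type _ := (Fin (n + 1) → X) → ZMod 2

/-- The coboundary `(δφ)(x₀, …, xₙ₊₁) = ∑ᵢ φ(x₀, …, x̂ᵢ, …, xₙ₊₁)` (no signs, as `2 = 0`). -/
def coboundary {X : Type*} {n : ℕ} : Cochain X n →+ Cochain X (n + 1) where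
  toFun φ x := ∑ i : Fin (n + 2), φ fun j => x (i.succAbove j)
  map_zero' := by funext x; simp
  map_add' φ ψ := by funext x; simp [Finset.sum_add_distrib]

/-- The locally zero cochains: those which vanish on `U ^ (n + 1)` for all `U` in some
open cover. -/
def locallyZero (X : Type*) [TopologicalSpace X] (n : ℕ) : AddSubgroup (Cochain X n) where
  carrier := {φ | ∀ p : X, ∃ U ∈ 𝓝 p, ∀ x : Fin (n + 1) → X, (∀ i, x i ∈ U) → φ x = 0}
  zero_mem' p := ⟨Set.univ, Filter.univ_mem, fun _ _ => rfl⟩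
  add_mem' := by
    intro φ ψ hφ hψ p
    obtain ⟨U, hU, h1⟩ := hφ p
    obtain ⟨V, hV, h2⟩ := hψ p
    refine ⟨U ∩ V, Filter.inter_mem hU hV, fun x hx => ?_⟩
    simp [h1 x fun i => (hx i).1, h2 x fun i => (hx i).2]
  neg_mem' := by
    intro φ hφ p
    obtain ⟨U, hU, h1⟩ := hφ p
    exact ⟨U, hU, fun x hx => by simp [h1 x hx]⟩

/-- Cochains representing cocycles of the quotient complex `Cochain / locallyZero`. -/
def cocycles (X : Type*) [TopologicalSpace X] (n : ℕ) : AddSubgroup (Cochain X n) :=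
  (locallyZero X (n + 1)).comap coboundary

/-- Cochains representing coboundaries of the quotient complex `Cochain / locallyZero`. -/
def coboundaries (X : Type*) [TopologicalSpace X] : (n : ℕ) → AddSubgroup (Cochain X n)
  | 0 => locallyZero X 0
  | n + 1 => locallyZero X (n + 1) ⊔ (coboundary (X := X) (n := n)).range

/-- Alexander-Spanier cohomology `Hⁿ(X; ℤ/2)`. -/
abbrev H (X : Type*) [TopologicalSpace X] (n : ℕ) : Type _ :=
  cocycles X n ⧸ (coboundaries X n).addSubgroupOf (cocycles X n)

/-- The cohomology class of a cocycle. -/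
def mk {X : Type*} [TopologicalSpace X] {n : ℕ} (φ : cocycles X n) : H X n :=
  QuotientAddGroup.mk φ

/-- The cup product on cochains,
`(φ ∪ ψ)(x₀, …, xₚ₊ᵩ) = φ(x₀, …, xₚ) ψ(xₚ, …, xₚ₊ᵩ)`. -/
def cupCochain {X : Type*} {p q : ℕ} (φ : Cochain X p) (ψ : Cochain X q) : Cochain X (p + q) :=
  fun x => φ (fun i => x ⟨i, by omega⟩) * ψ (fun j => x ⟨p + j, by omega⟩)

theorem coboundary_comp_val {X : Type*} {n : ℕ} (φ : Cochain X n) (y : ℕ → X) :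
    coboundary φ (fun i => y i) =
      ∑ i ∈ Finset.range (n + 2), φ fun j => y (if (j : ℕ) < i then (j : ℕ) else j + 1) := by
  rw [Finset.sum_range]
  change ∑ i : Fin (n + 2), _ = _
  refine Finset.sum_congr rfl fun i _ => congrArg φ (funext fun j => congrArg y ?_)
  simp only [Fin.succAbove, Fin.lt_def, Fin.val_castSucc]
  split_ifs <;> simp

/-- The Leibniz rule modulo 2. -/
theorem coboundary_cupCochain {X : Type*} {p q : ℕ} (φ : Cochain X p) (ψ : Cochain X q)
    (x : Fin (p + q + 1 + 1) → X) :
    coboundary (cupCochain φ ψ) x =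
      coboundary φ (fun i => x ⟨i, by omega⟩) * ψ (fun j => x ⟨p + 1 + j, by omega⟩) +
        φ (fun i => x ⟨i, by omega⟩) * coboundary ψ (fun j => x ⟨p + j, by omega⟩) := by
  obtain ⟨y, rfl⟩ : ∃ y : ℕ → X, x = fun i : Fin (p + q + 1 + 1) => y i := by
    refine ⟨fun k => if h : k < p + q + 1 + 1 then x ⟨k, h⟩ else x 0, ?_⟩
    funext i
    simp [i.2]
  simp only
  rw [coboundary_comp_val, coboundary_comp_val φ y,
    coboundary_comp_val ψ (fun j => y (p + j))]
  rw [show p + q + 2 = (p + 1) + (q + 1) by omega, Finset.sum_range_add,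
    Finset.sum_range_succ _ (p + 1), Finset.sum_range_succ' _ (q + 1), add_mul, Finset.sum_mul,
    mul_add, Finset.mul_sum]
  have h1 : ∀ i ∈ Finset.range (p + 1),
      cupCochain φ ψ (fun j => y (if (j : ℕ) < i then (j : ℕ) else j + 1)) =
      φ (fun j => y (if (j : ℕ) < i then (j : ℕ) else j + 1)) * ψ (fun j => y (p + 1 + j)) := by
    intro i hi
    rw [Finset.mem_range] at hi
    refine congrArg₂ _ rfl (congrArg ψ (funext fun j => congrArg y ?_))
    simp only
    split_ifs <;> omega
  have h2 : ∀ i ∈ Finset.range (q + 1),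
      cupCochain φ ψ (fun j => y (if (j : ℕ) < p + 1 + i then (j : ℕ) else j + 1)) =
      φ (fun j => y j) * ψ (fun j => y (p + if (j : ℕ) < i + 1 then (j : ℕ) else j + 1)) := by
    intro i hi
    refine congrArg₂ _ (congrArg φ (funext fun j => congrArg y ?_))
      (congrArg ψ (funext fun j => congrArg y ?_))
    · simp only
      split_ifs <;> omega
    · simp only
      split_ifs <;> omega
  rw [Finset.sum_congr rfl h1, Finset.sum_congr rfl h2]
  have h3 : (φ fun j => y (if (j : ℕ) < p + 1 then (j : ℕ) else j + 1)) = φ fun j => y j := by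
    refine congrArg φ (funext fun j => congrArg y ?_)
    split_ifs <;> omega
  have h4 : (ψ fun j => y (p + if (j : ℕ) < 0 then (j : ℕ) else j + 1)) =
      ψ fun j => y (p + 1 + j) := by
    refine congrArg ψ (funext fun j => congrArg y ?_)
    simp; omega
  rw [h3, h4]
  generalize (φ fun j => y j) * (ψ fun j => y (p + 1 + j)) = a
  have ha : a + a = 0 := CharTwo.add_self_eq_zero a
  linear_combination -ha

section Cup

variable {X : Type*} [TopologicalSpace X] {p q : ℕ}

theorem locallyZero_of_left {n m k : ℕ} {ζ : Cochain X m} (hζ : ζ ∈ locallyZero X m)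
    (a : Fin (m + 1) → Fin (n + 1)) (b : Fin (k + 1) → Fin (n + 1)) (χ : Cochain X k) :
    (fun x : Fin (n + 1) → X => ζ (fun i => x (a i)) * χ (fun i => x (b i))) ∈
      locallyZero X n := by
  intro r
  obtain ⟨U, hU, h⟩ := hζ r
  exact ⟨U, hU, fun x hx => by simp [h _ fun i => hx (a i)]⟩

theorem locallyZero_of_right {n m k : ℕ} {ζ : Cochain X m} (hζ : ζ ∈ locallyZero X m)
    (a : Fin (m + 1) → Fin (n + 1)) (b : Fin (k + 1) → Fin (n + 1)) (χ : Cochain X k) :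
    (fun x : Fin (n + 1) → X => χ (fun i => x (b i)) * ζ (fun i => x (a i))) ∈
      locallyZero X n := by
  simpa only [mul_comm] using locallyZero_of_left hζ a b χ

theorem cupCochain_mem_cocycles {φ : Cochain X p} {ψ : Cochain X q} (hφ : φ ∈ cocycles X p)
    (hψ : ψ ∈ cocycles X q) : cupCochain φ ψ ∈ cocycles X (p + q) := by
  change coboundary (cupCochain φ ψ) ∈ locallyZero X (p + q + 1)
  rw [show coboundary (cupCochain φ ψ) = _ from funext (coboundary_cupCochain φ ψ)]
  exact add_mem
    (locallyZero_of_left (n := p + q + 1) hφ (fun i => ⟨i, by omega⟩)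
      (fun j => ⟨p + 1 + j, by omega⟩) ψ)
    (locallyZero_of_right (n := p + q + 1) hψ (fun i => ⟨p + i, by omega⟩)
      (fun j => ⟨j, by omega⟩) φ)

theorem locallyZero_le_coboundaries (n : ℕ) : locallyZero X n ≤ coboundaries X n := by
  cases n with
  | zero => exact le_refl _
  | succ n => exact le_sup_left

theorem mem_coboundaries_of_eq {n m : ℕ} (h : n = m + 1) (χ : Cochain X m) (φ : Cochain X n)
    (hφ : (fun x : Fin (n + 1) → X => φ x - coboundary χ fun i => x ⟨i, by omega⟩) ∈
      locallyZero X n) : φ ∈ coboundaries X n := by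
  subst h
  have : φ = (fun x => φ x - coboundary χ x) + coboundary χ := by funext x; simp
  rw [this]
  exact AddSubgroup.add_mem_sup hφ ⟨χ, rfl⟩

theorem cupCochain_add (φ : Cochain X p) (ψ ψ' : Cochain X q) :
    cupCochain φ (ψ + ψ') = cupCochain φ ψ + cupCochain φ ψ' := by
  funext x; simp [cupCochain, mul_add]

theorem add_cupCochain (φ φ' : Cochain X p) (ψ : Cochain X q) :
    cupCochain (φ + φ') ψ = cupCochain φ ψ + cupCochain φ' ψ := by
  funext x; simp [cupCochain, add_mul]

theorem cupCochain_mem_of_left {φ : Cochain X p} {ψ : Cochain X q} (hφ : φ ∈ coboundaries X p)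
    (hψ : ψ ∈ cocycles X q) : cupCochain φ ψ ∈ coboundaries X (p + q) := by
  have hz : ∀ ζ ∈ locallyZero X p, cupCochain ζ ψ ∈ coboundaries X (p + q) := fun ζ hζ =>
    locallyZero_le_coboundaries _ (locallyZero_of_left (n := p + q) hζ (fun i => ⟨i, by omega⟩)
      (fun j => ⟨p + j, by omega⟩) ψ)
  cases p with
  | zero => exact hz φ hφ
  | succ p =>
    obtain ⟨ζ, hζ, _, ⟨χ, rfl⟩, rfl⟩ := AddSubgroup.mem_sup.1 hφ
    rw [add_cupCochain]
    refine add_mem (hz ζ hζ) (mem_coboundaries_of_eq (m := p + q) (by omega) (cupCochain χ ψ) _ ?_)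
    have key : ∀ x : Fin (p + 1 + q + 1) → X, cupCochain (coboundary χ) ψ x -
        coboundary (cupCochain χ ψ) (fun i => x ⟨i, by omega⟩) =
        -(χ (fun i => x ⟨i, by omega⟩) * coboundary ψ (fun j => x ⟨p + j, by omega⟩)) := by
      intro x
      rw [coboundary_cupCochain]
      simp only [cupCochain]
      ring
    rw [funext key]
    exact neg_mem (locallyZero_of_right (n := p + 1 + q) hψ (fun j => ⟨p + j, by omega⟩)
      (fun i => ⟨i, by omega⟩) χ)

theorem cupCochain_mem_of_right {φ : Cochain X p} {ψ : Cochain X q} (hφ : φ ∈ cocycles X p)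
    (hψ : ψ ∈ coboundaries X q) : cupCochain φ ψ ∈ coboundaries X (p + q) := by
  have hz : ∀ ζ ∈ locallyZero X q, cupCochain φ ζ ∈ coboundaries X (p + q) := fun ζ hζ =>
    locallyZero_le_coboundaries _ (locallyZero_of_right (n := p + q) hζ
      (fun j => ⟨p + j, by omega⟩) (fun i => ⟨i, by omega⟩) φ)
  cases q with
  | zero => exact hz ψ hψ
  | succ q =>
    obtain ⟨ζ, hζ, _, ⟨χ, rfl⟩, rfl⟩ := AddSubgroup.mem_sup.1 hψ
    rw [cupCochain_add]
    refine add_mem (hz ζ hζ) (mem_coboundaries_of_eq (m := p + q) (by omega) (cupCochain φ χ) _ ?_)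
    have key : ∀ x : Fin (p + (q + 1) + 1) → X, cupCochain φ (coboundary χ) x -
        coboundary (cupCochain φ χ) (fun i => x ⟨i, by omega⟩) =
        -(coboundary φ (fun i => x ⟨i, by omega⟩) * χ (fun j => x ⟨p + 1 + j, by omega⟩)) := by
      intro x
      rw [coboundary_cupCochain]
      simp only [cupCochain]
      ring
    rw [funext key]
    exact neg_mem (locallyZero_of_left (n := p + (q + 1)) hφ (fun i => ⟨i, by omega⟩)
      (fun j => ⟨p + 1 + j, by omega⟩) χ)

/-- The cup product on Alexander-Spanier cohomology. -/
def cup : H X p → H X q → H X (p + q) :=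
  Quotient.map₂ (fun φ ψ => ⟨cupCochain φ.1 ψ.1, cupCochain_mem_cocycles φ.2 ψ.2⟩) (by
    intro φ φ' hφ ψ ψ' hψ
    have hφ := QuotientAddGroup.leftRel_apply.1 hφ
    have hψ := QuotientAddGroup.leftRel_apply.1 hψ
    refine QuotientAddGroup.leftRel_apply.2 ?_
    rw [AddSubgroup.mem_addSubgroupOf] at hφ hψ ⊢
    have : -cupCochain φ.1 ψ.1 + cupCochain φ'.1 ψ'.1 =
        cupCochain (-φ.1 + φ'.1) ψ'.1 + cupCochain φ.1 (-ψ.1 + ψ'.1) := by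
      funext x
      simp only [cupCochain, Pi.add_apply, Pi.neg_apply]
      ring
    change -cupCochain φ.1 ψ.1 + cupCochain φ'.1 ψ'.1 ∈ coboundaries X (p + q)
    rw [this]
    exact add_mem (cupCochain_mem_of_left hφ ψ'.2) (cupCochain_mem_of_right φ.2 hψ))

theorem cup_mk (φ : cocycles X p) (ψ : cocycles X q) :
    cup (mk φ) (mk ψ) = mk ⟨cupCochain φ.1 ψ.1, cupCochain_mem_cocycles φ.2 ψ.2⟩ := rfl

variable (X) in
/-- The unit of the cohomology ring: the class of the constant cochain `1`. -/
def one : H X 0 :=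
  mk ⟨fun _ => 1, by
    have : coboundary (X := X) (n := 0) (fun _ => 1) = 0 := by
      funext x
      change ∑ i : Fin 2, (1 : ZMod 2) = 0
      decide
    change coboundary (X := X) (n := 0) (fun _ => 1) ∈ locallyZero X 1
    rw [this]
    exact zero_mem _⟩

/-- The `k`-fold cup power `aᵏ` of a class of degree one. -/
def pow (a : H X 1) : (k : ℕ) → H X k
  | 0 => one X
  | k + 1 => cup (pow a k) a

end Cup

section Pullback

variable {X Y : Type*} [TopologicalSpace X] [TopologicalSpace Y]

/-- Pullback of cochains along a map. -/
def pullbackCochain (f : X → Y) (n : ℕ) : Cochain Y n →+ Cochain X n where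
  toFun φ x := φ fun i => f (x i)
  map_zero' := rfl
  map_add' _ _ := rfl

theorem coboundary_pullbackCochain (f : X → Y) {n : ℕ} (φ : Cochain Y n) :
    coboundary (pullbackCochain f n φ) = pullbackCochain f (n + 1) (coboundary φ) := rfl

theorem pullbackCochain_locallyZero (f : C(X, Y)) {n : ℕ} {φ : Cochain Y n}
    (hφ : φ ∈ locallyZero Y n) : pullbackCochain f n φ ∈ locallyZero X n := by
  intro p
  obtain ⟨U, hU, h⟩ := hφ (f p)
  exact ⟨f ⁻¹' U, f.continuous.continuousAt hU, fun x hx => h _ hx⟩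

theorem pullbackCochain_cocycles (f : C(X, Y)) {n : ℕ} {φ : Cochain Y n}
    (hφ : φ ∈ cocycles Y n) : pullbackCochain f n φ ∈ cocycles X n :=
  pullbackCochain_locallyZero f (n := n + 1) hφ

theorem pullbackCochain_coboundaries (f : C(X, Y)) {n : ℕ} {φ : Cochain Y n}
    (hφ : φ ∈ coboundaries Y n) : pullbackCochain f n φ ∈ coboundaries X n := by
  cases n with
  | zero => exact pullbackCochain_locallyZero f hφ
  | succ n =>
    obtain ⟨ζ, hζ, _, ⟨χ, rfl⟩, rfl⟩ := AddSubgroup.mem_sup.1 hφ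
    rw [map_add]
    exact AddSubgroup.add_mem_sup (pullbackCochain_locallyZero f hζ) ⟨pullbackCochain f n χ, rfl⟩

/-- The homomorphism `f^* : Hⁿ(Y) → Hⁿ(X)` induced by a continuous map. -/
def pullback (f : C(X, Y)) (n : ℕ) : H Y n →+ H X n :=
  QuotientAddGroup.map _ _
    (((pullbackCochain f n).comp (cocycles Y n).subtype).codRestrict (cocycles X n)
      fun φ => pullbackCochain_cocycles f φ.2)
    fun _ hφ => pullbackCochain_coboundaries f hφ

end Pullback

end AlexanderSpanier

namespace Z2Index

/-- The infinite sphere `S^∞`: finitely supported real sequences of Euclidean norm one. -/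
def InfSphere : Type := {x : ℕ →₀ ℝ // ∑ i ∈ x.support, x i ^ 2 = 1}

/-- The finite-dimensional sphere `Sᵐ ⊆ S^∞` of sequences supported in `{0, …, m}`. -/
def Skeleton (m : ℕ) : Type := {x : InfSphere // ∀ i, m < i → x.1 i = 0}

/-- `Sᵐ` has its Euclidean topology, which is the topology of coordinatewise convergence. -/
instance (m : ℕ) : TopologicalSpace (Skeleton m) :=
  TopologicalSpace.induced (fun x => (fun i => x.1.1 i : ℕ → ℝ)) inferInstance

/-- `S^∞` has the direct limit topology of `S⁰ ⊆ S¹ ⊆ S² ⊆ ⋯`: a set is open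
if and only if its intersection with every `Sᵐ` is open. -/
instance : TopologicalSpace InfSphere :=
  ⨆ m : ℕ, TopologicalSpace.coinduced (fun x : Skeleton m => x.1) inferInstance

/-- The antipodal map of `S^∞`. -/
def antipode (x : InfSphere) : InfSphere :=
  ⟨-x.1, by simpa [Finsupp.support_neg] using x.2⟩

theorem antipode_involutive : Function.Involutive antipode := fun x =>
  Subtype.ext (neg_neg x.1)

/-- The orbit relation of the `ℤ/2`-action generated by an involution `τ`. -/
def orbitSetoid {X : Type*} (τ : X → X) (hτ : Function.Involutive τ) : Setoid X where
  r x y := y = x ∨ y = τ x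
  iseqv :=
    { refl := fun x => Or.inl rfl
      symm := by
        rintro x y (rfl | rfl)
        · exact Or.inl rfl
        · exact Or.inr (hτ x).symm
      trans := by
        rintro x y z (rfl | rfl) (rfl | rfl)
        · exact Or.inl rfl
        · exact Or.inr rfl
        · exact Or.inr rfl
        · exact Or.inl (hτ x) }

/-- The orbit space `X / (ℤ/2)`, with the quotient topology. -/
abbrev OrbitSpace {X : Type*} (τ : X → X) (hτ : Function.Involutive τ) : Type _ :=
  Quotient (orbitSetoid τ hτ)

/-- Infinite real projective space, `S^∞` modulo the antipodal map. -/
abbrev RPInf : Type := OrbitSpace antipode antipode_involutive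

/-- The map of orbit spaces `X / (ℤ/2) → RP^∞` induced by an equivariant continuous map
`F : X → S^∞`. It exhibits the double cover `X → X / (ℤ/2)` as the pullback of
`S^∞ → RP^∞`, i.e. it is a classifying map; every classifying map is of this form. -/
def classifyingMap {X : Type*} [TopologicalSpace X] (τ : X → X) (hτ : Function.Involutive τ)
    (F : C(X, InfSphere)) (hF : ∀ x, F (τ x) = antipode (F x)) :
    C(OrbitSpace τ hτ, RPInf) where
  toFun := Quotient.map F (by
    rintro x y (rfl | rfl)
    · exact Or.inl rfl
    · exact Or.inr (hF x))
  continuous_toFun := F.continuous.quotient_map' _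

/-- The `ℤ/2`-index of a space `X` with the `ℤ/2`-action generated by `τ`: the largest `k + 1` such
that `f^*(μᵏ) ≠ 0` in the Alexander-Spanier cohomology of `X / (ℤ/2)`, where `f` is the classifying
map of `X → X / (ℤ/2)` and `μ` is the generator (the non-zero element) of `H¹(RP^∞; ℤ/2)`.
It is `0` if there is no such `k` and `⊤` if there is no largest one. -/
def index {X : Type*} [TopologicalSpace X] (τ : X → X) (hτ : Function.Involutive τ) : ℕ∞ :=
  sSup {N : ℕ∞ | ∃ k : ℕ, N = k + 1 ∧
    ∃ (F : C(X, InfSphere)) (hF : ∀ x, F (τ x) = antipode (F x)) (μ : AlexanderSpanier.H RPInf 1),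
      μ ≠ 0 ∧
      AlexanderSpanier.pullback (classifyingMap τ hτ F hF) k (AlexanderSpanier.pow μ k) ≠ 0}

/-- The restriction of `u ↦ -u` to an invariant subset of an additive group. -/
def negOn {E : Type*} [AddGroup E] {A : Set E} (hA : ∀ u ∈ A, -u ∈ A) (u : A) : A :=
  ⟨-u, hA u u.2⟩

theorem negOn_involutive {E : Type*} [AddGroup E] {A : Set E} (hA : ∀ u ∈ A, -u ∈ A) :
    Function.Involutive (negOn hA) := fun u => Subtype.ext (neg_neg (u : E))

/-- The compact subsets of `E \ {0}`, invariant under `u ↦ -u`, of `ℤ/2`-index at least `N`. -/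
def compactSymmetric (E : Type*) [AddGroup E] [TopologicalSpace E] (N : ℕ) : Set (Set E) :=
  {A | A ⊆ {0}ᶜ ∧ IsCompact A ∧
    ∃ hA : ∀ u ∈ A, -u ∈ A, (N : ℕ∞) ≤ index (negOn hA) (negOn_involutive hA)}

end Z2Index

namespace AllenCahn

/-- Even double-well potentials. -/
structure IsDoubleWell (W : ℝ → ℝ) : Prop where
  smooth : ContDiff ℝ ∞ W
  nonneg : ∀ x, 0 ≤ W x
  even : ∀ x, W x = W (-x)
  wells : W 1 = 0 ∧ W (-1) = 0
  wells_nondegenerate : 0 < iteratedDeriv 2 W 1 ∧ 0 < iteratedDeriv 2 W (-1)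
  isLocalMax_zero : IsLocalMax W 0
  zero_pos : 0 < W 0
  zero_nondegenerate : iteratedDeriv 2 W 0 < 0
  increasing : MonotoneOn W (Set.Ioo (-1) 0) ∧ MonotoneOn W (Set.Ioi 1)
  decreasing : AntitoneOn W (Set.Ioo 0 1) ∧ AntitoneOn W (Set.Iio (-1))
  convex_outside : ∃ κ α : ℝ, 0 < κ ∧ 0 < α ∧ α < 1 ∧ ∀ x, α ≤ |x| → κ ≤ iteratedDeriv 2 W x

/-- The constant `σ = ∫_{-1}^1 √(W(s)/2) ds`. -/
def sigma (W : ℝ → ℝ) : ℝ := ∫ s in (-1 : ℝ)..1, √(W s / 2)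

section Manifold

variable {d : ℕ} {M : Type*} [TopologicalSpace M] [ChartedSpace (EuclideanSpace ℝ (Fin d)) M]
  [IsManifold (𝓡 d) ∞ M]

variable (d) in
/-- The `i`-th coordinate vector field `∂ᵢ` at `x` of the preferred chart at `c` (it is the image of the
`i`-th standard basis vector under the derivative of the inverse chart, for `x` in the chart domain). -/
def coordFrame (c x : M) (i : Fin d) : TangentSpace (𝓡 d) x :=
  (trivializationAt (EuclideanSpace ℝ (Fin d)) (TangentSpace (𝓡 d) : M → Type _) c).symmL ℝ x
    (EuclideanSpace.single i 1)

theorem continuousOn_coordFrame (c : M) (i : Fin d) :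
    ContinuousOn (fun x : M => (⟨x, coordFrame d c x i⟩ : TangentBundle (𝓡 d) M))
      (chartAt (EuclideanSpace ℝ (Fin d)) c).source := by
  have h := (trivializationAt (EuclideanSpace ℝ (Fin d))
    (TangentSpace (𝓡 d) : M → Type _) c).continuousOn_symm
  have h2 : ContinuousOn (fun x : M => (x, (EuclideanSpace.single i 1 : EuclideanSpace ℝ (Fin d))))
      (chartAt (EuclideanSpace ℝ (Fin d)) c).source := by fun_prop
  refine (h.comp h2 fun x hx => ⟨hx, trivial⟩).congr fun x hx => ?_
  simp only [coordFrame, Function.comp]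
  rw [Trivialization.symmL_apply _ hx]

theorem coordFrame_eq (c x : M) (hx : x ∈ (chartAt (EuclideanSpace ℝ (Fin d)) c).source) :
    ∃ b : Module.Basis (Fin d) ℝ (TangentSpace (𝓡 d) x), ∀ i, b i = coordFrame d c x i := by
  let e := (trivializationAt (EuclideanSpace ℝ (Fin d))
    (TangentSpace (𝓡 d) : M → Type _) c).continuousLinearEquivAt ℝ x hx
  refine ⟨(EuclideanSpace.basisFun (Fin d) ℝ).toBasis.map e.symm.toLinearEquiv, fun i => ?_⟩
  simp only [Module.Basis.map_apply, OrthonormalBasis.coe_toBasis, EuclideanSpace.basisFun_apply,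
    coordFrame]
  rw [← Trivialization.symm_continuousLinearEquivAt_eq _ hx]
  rfl

theorem continuousOn_mfderiv_coordFrame {f : M → ℝ} (hf : ContMDiff (𝓡 d) 𝓘(ℝ, ℝ) ∞ f) (c : M)
    (i : Fin d) :
    ContinuousOn (fun x : M => (mfderiv (𝓡 d) 𝓘(ℝ, ℝ) f x (coordFrame d c x i) : ℝ))
      (chartAt (EuclideanSpace ℝ (Fin d)) c).source := by
  have h := (hf.continuous_tangentMap (by simp)).comp_continuousOn (continuousOn_coordFrame c i)
  have h2 := (tangentBundleModelSpaceHomeomorph 𝓘(ℝ, ℝ)).continuous.comp_continuousOn h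
  exact (continuous_snd.comp_continuousOn (s := (chartAt (EuclideanSpace ℝ (Fin d)) c).source)
    (f := fun x => ((f x, mfderiv (𝓡 d) 𝓘(ℝ, ℝ) f x (coordFrame d c x i)) : ℝ × ℝ)) h2)

variable [RiemannianBundle (fun x : M => TangentSpace (𝓡 d) x)]

instance completeSpace_tangentSpace (x : M) : CompleteSpace (TangentSpace (𝓡 d) x) :=
  have : FiniteDimensional ℝ (TangentSpace (𝓡 d) x) :=
    inferInstanceAs (FiniteDimensional ℝ (EuclideanSpace ℝ (Fin d)))
  FiniteDimensional.complete ℝ _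

variable (d) in
/-- The differential `df_x`. -/
def differential (f : M → ℝ) (x : M) : TangentSpace (𝓡 d) x →L[ℝ] ℝ :=
  mfderiv (𝓡 d) 𝓘(ℝ, ℝ) f x

variable (d) in
/-- The Riemannian gradient `∇f`, defined by `⟨∇f, v⟩ = df(v)`. -/
def gradient (f : M → ℝ) (x : M) : TangentSpace (𝓡 d) x :=
  (InnerProductSpace.toDual ℝ (TangentSpace (𝓡 d) x)).symm (differential d f x)

theorem inner_gradient (f : M → ℝ) (x : M) (v : TangentSpace (𝓡 d) x) :
    inner ℝ (gradient d f x) v = (mfderiv (𝓡 d) 𝓘(ℝ, ℝ) f x v : ℝ) :=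
  InnerProductSpace.toDual_symm_apply

theorem gram_posDef (c x : M) (hx : x ∈ (chartAt (EuclideanSpace ℝ (Fin d)) c).source) :
    (Matrix.gram ℝ (coordFrame d c x)).PosDef := by
  obtain ⟨b, hb⟩ := coordFrame_eq c x hx
  rw [← show ⇑b = coordFrame d c x from funext hb]
  exact Matrix.posDef_gram_of_linearIndependent b.linearIndependent

variable (d) in
/-- The partial derivatives `∂ᵢf` in the preferred chart at `c`. -/
def coordDeriv (f : M → ℝ) (c x : M) : Fin d → ℝ :=
  fun i => mfderiv (𝓡 d) 𝓘(ℝ, ℝ) f x (coordFrame d c x i)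

theorem inner_gradient_gradient (f h : M → ℝ) (c x : M)
    (hx : x ∈ (chartAt (EuclideanSpace ℝ (Fin d)) c).source) :
    inner ℝ (gradient d f x) (gradient d h x) =
      coordDeriv d f c x ⬝ᵥ
        ((Matrix.gram ℝ (coordFrame d c x))⁻¹ *ᵥ coordDeriv d h c x) := by
  obtain ⟨b, hb⟩ := coordFrame_eq c x hx
  have hG := gram_posDef c x hx
  set G := Matrix.gram ℝ (coordFrame d c x) with hGdef
  have key : coordDeriv d h c x = G *ᵥ (fun j => b.repr (gradient d h x) j) := by
    funext i
    rw [coordDeriv, ← inner_gradient]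
    conv_lhs => rw [← b.sum_repr (gradient d h x)]
    rw [sum_inner]
    simp only [Matrix.mulVec, dotProduct, hGdef, Matrix.gram_apply, hb, inner_smul_left]
    refine Finset.sum_congr rfl fun j _ => ?_
    rw [real_inner_comm, mul_comm]; rfl
  rw [key, Matrix.mulVec_mulVec, Matrix.nonsing_inv_mul _ hG.det_pos.ne'.isUnit, Matrix.one_mulVec]
  conv_lhs => rw [← b.sum_repr (gradient d h x)]
  rw [inner_sum]
  simp only [inner_smul_right, inner_gradient, dotProduct, hb, coordDeriv]
  exact Finset.sum_congr rfl fun j _ => mul_comm _ _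

variable [hR : IsContMDiffRiemannianBundle (𝓡 d) ∞ (EuclideanSpace ℝ (Fin d))
  (fun x : M => TangentSpace (𝓡 d) x)]

theorem continuousOn_gram (c : M) :
    ContinuousOn (fun x : M => Matrix.gram ℝ (coordFrame d c x))
      (chartAt (EuclideanSpace ℝ (Fin d)) c).source := by
  have : IsContinuousRiemannianBundle (EuclideanSpace ℝ (Fin d))
      (fun x : M => TangentSpace (𝓡 d) x) := by
    obtain ⟨g, hg, h⟩ := hR.exists_contMDiff
    exact ⟨g, hg.continuous, h⟩
  refine continuousOn_pi.2 fun i => continuousOn_pi.2 fun j => ?_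
  exact (continuousOn_coordFrame c i).inner_bundle (continuousOn_coordFrame c j)

theorem continuous_inner_gradient {f h : M → ℝ} (hf : ContMDiff (𝓡 d) 𝓘(ℝ, ℝ) ∞ f)
    (hh : ContMDiff (𝓡 d) 𝓘(ℝ, ℝ) ∞ h) :
    Continuous (fun x : M => (inner ℝ (gradient d f x) (gradient d h x) : ℝ)) := by
  rw [continuous_iff_continuousAt]
  intro c
  have hU : (chartAt (EuclideanSpace ℝ (Fin d)) c).source ∈ 𝓝 c :=
    (chartAt (EuclideanSpace ℝ (Fin d)) c).open_source.mem_nhds (mem_chart_source _ c)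
  refine ContinuousOn.continuousAt ?_ hU
  refine ContinuousOn.congr ?_ fun x hx => inner_gradient_gradient f h c x hx
  have hinv : ContinuousOn (fun x : M => (Matrix.gram ℝ (coordFrame d c x))⁻¹)
      (chartAt (EuclideanSpace ℝ (Fin d)) c).source := by
    simp only [Matrix.inv_def, Ring.inverse_eq_inv']
    have hG := continuousOn_gram (d := d) c
    exact ((continuous_id.matrix_det.comp_continuousOn hG).inv₀
      fun x hx => (gram_posDef c x hx).det_pos.ne').smul
      (continuous_id.matrix_adjugate.comp_continuousOn hG)
  have h1 := fun i => continuousOn_mfderiv_coordFrame hf c i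
  have h2 := fun i => continuousOn_mfderiv_coordFrame hh c i
  simp only [dotProduct, Matrix.mulVec, coordDeriv]
  refine continuousOn_finsetSum _ fun i _ => (h1 i).mul ?_
  refine continuousOn_finsetSum _ fun j _ => ContinuousOn.mul ?_ (h2 j)
  exact (continuous_apply_apply i j).comp_continuousOn hinv

variable [T2Space M] [CompactSpace M]

variable (d M) in
/-- A smooth partition of unity subordinate to the preferred charts. -/
def chartPartition : SmoothPartitionOfUnity M (𝓡 d) M Set.univ :=
  Classical.choose (SmoothPartitionOfUnity.exists_isSubordinate_chartAt_source (𝓡 d) M)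

theorem chartPartition_isSubordinate : (chartPartition d M).IsSubordinate
    fun c : M => (chartAt (EuclideanSpace ℝ (Fin d)) c).source :=
  Classical.choose_spec (SmoothPartitionOfUnity.exists_isSubordinate_chartAt_source (𝓡 d) M)

variable [MeasurableSpace M] [BorelSpace M]

variable (d) in
/-- The measure `√(det gᵢⱼ) dx¹ ⋯ dxᵈ` on the domain of the preferred chart at `c`, as a measure on `M`. -/
def chartVolume (c : M) : Measure M :=
  ((volume.restrict (extChartAt (𝓡 d) c).target).withDensity fun y =>
    ENNReal.ofReal √(Matrix.gram ℝ (coordFrame d c ((extChartAt (𝓡 d) c).symm y))).det).map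
      (extChartAt (𝓡 d) c).symm

variable (d M) in
/-- The Riemannian volume measure, `∫ h dvol = ∑_c ∫ ρ_c h √(det gᵢⱼ) dx¹ ⋯ dxᵈ`. -/
def riemVolume : Measure M :=
  Measure.sum fun c : M =>
    (chartVolume d c).withDensity fun x => ENNReal.ofReal (chartPartition d M c x)

theorem chartVolume_lt_top (c : M) {K : Set M} (hK : IsCompact K)
    (hKc : K ⊆ (chartAt (EuclideanSpace ℝ (Fin d)) c).source) : chartVolume d c K < ⊤ := by
  set φ := extChartAt (𝓡 d) c with hφ
  have hmeas : MeasurableSet φ.target := (isOpen_extChartAt_target c).measurableSet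
  have hsymm : ContinuousOn φ.symm φ.target := continuousOn_extChartAt_symm c
  set D : EuclideanSpace ℝ (Fin d) → ℝ :=
    fun y => √(Matrix.gram ℝ (coordFrame d c (φ.symm y))).det with hD
  have hDc : ContinuousOn D φ.target := by
    have h1 := (continuousOn_gram (d := d) c).comp hsymm fun y hy => by
      simpa [hφ] using (φ.map_target hy)
    exact Real.continuous_sqrt.comp_continuousOn (continuous_id.matrix_det.comp_continuousOn h1)
  have hae : AEMeasurable φ.symm ((volume.restrict φ.target).withDensity fun y =>
      ENNReal.ofReal (D y)) :=
    (hsymm.aemeasurable hmeas).mono_ac (withDensity_absolutelyContinuous _ _)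
  have hK' : IsCompact (φ '' K) := hK.image_of_continuousOn
    ((continuousOn_extChartAt c).mono (by simpa using hKc))
  have hK't : φ '' K ⊆ φ.target := by
    rintro _ ⟨x, hx, rfl⟩
    exact φ.map_source (by simpa [hφ] using hKc hx)
  have hsub : φ.symm ⁻¹' K ∩ φ.target ⊆ φ '' K := fun y hy =>
    ⟨φ.symm y, hy.1, φ.right_inv hy.2⟩
  obtain ⟨C, hC⟩ := hK'.exists_bound_of_continuousOn (hDc.mono hK't)
  have hdef : chartVolume d c = ((volume.restrict φ.target).withDensity fun y =>
    ENNReal.ofReal (D y)).map φ.symm := rfl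
  rw [hdef, Measure.map_apply_of_aemeasurable hae hK.measurableSet]
  calc ((volume.restrict φ.target).withDensity fun y => ENNReal.ofReal (D y)) (φ.symm ⁻¹' K)
      ≤ ((volume.restrict φ.target).withDensity fun y => ENNReal.ofReal (D y))
          (φ '' K ∪ φ.targetᶜ) := by
        refine measure_mono fun y hy => ?_
        by_cases h : y ∈ φ.target
        · exact Or.inl (hsub ⟨hy, h⟩)
        · exact Or.inr h
    _ ≤ ((volume.restrict φ.target).withDensity fun y => ENNReal.ofReal (D y)) (φ '' K) + 
        ((volume.restrict φ.target).withDensity fun y => ENNReal.ofReal (D y)) (φ.targetᶜ) :=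
        measure_union_le _ _
    _ = ((volume.restrict φ.target).withDensity fun y => ENNReal.ofReal (D y)) (φ '' K) := by
        rw [withDensity_absolutelyContinuous (volume.restrict φ.target) _
          (show volume.restrict φ.target φ.targetᶜ = 0 by
            rw [Measure.restrict_apply hmeas.compl]; simp), add_zero]
    _ = ∫⁻ y in φ '' K, ENNReal.ofReal (D y) ∂(volume.restrict φ.target) :=
        withDensity_apply _ hK'.measurableSet
    _ ≤ ∫⁻ y in φ '' K, ENNReal.ofReal C ∂(volume.restrict φ.target) := by
        refine setLIntegral_mono measurable_const fun y hy => ENNReal.ofReal_le_ofReal ?_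
        exact (le_abs_self _).trans (hC y hy)
    _ < ⊤ := by
        rw [setLIntegral_const]
        exact ENNReal.mul_lt_top ENNReal.ofReal_lt_top
          ((Measure.restrict_apply_le _ _).trans_lt hK'.measure_lt_top)

instance isFiniteMeasure_riemVolume : IsFiniteMeasure (riemVolume d M) := by
  constructor
  set ρ := chartPartition d M
  have hfin : {c : M | (Function.support (ρ c)).Nonempty}.Finite :=
    ρ.locallyFinite.finite_nonempty_of_compact
  have hle : ∀ c : M, ((chartVolume d c).withDensity fun x => ENNReal.ofReal (ρ c x)) Set.univ
      ≤ chartVolume d c (tsupport (ρ c)) := by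
    intro c
    rw [withDensity_apply _ MeasurableSet.univ, Measure.restrict_univ,
      ← lintegral_indicator_one (isClosed_tsupport _).measurableSet]
    refine lintegral_mono fun x => ?_
    by_cases hx : x ∈ tsupport (ρ c)
    · simpa [hx] using ρ.le_one c x
    · simp [hx, image_eq_zero_of_notMem_tsupport hx]
  have hlt : ∀ c : M, ((chartVolume d c).withDensity fun x => ENNReal.ofReal (ρ c x)) Set.univ
      < ⊤ := fun c => (hle c).trans_lt (chartVolume_lt_top c (isClosed_tsupport _).isCompact
        (chartPartition_isSubordinate c))
  rw [riemVolume, Measure.sum_apply _ MeasurableSet.univ, tsum_eq_sum (s := hfin.toFinset)]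
  · exact ENNReal.sum_lt_top.2 fun c _ => hlt c
  · intro c hc
    have hz : ∀ x, ρ c x = 0 := by
      intro x
      by_contra h
      exact hc (hfin.mem_toFinset.2 ⟨x, h⟩)
    rw [withDensity_apply _ MeasurableSet.univ]
    simp [show chartPartition d M = ρ from rfl, hz]

variable (d M) in
/-- The smooth functions on `M`, to be equipped with the `W^{1,2}` inner product. -/
def SmoothFn : Type _ := C^∞⟮𝓡 d, M; 𝓘(ℝ, ℝ), ℝ⟯

instance : AddCommGroup (SmoothFn d M) :=
  inferInstanceAs (AddCommGroup C^∞⟮𝓡 d, M; 𝓘(ℝ, ℝ), ℝ⟯)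

instance : Module ℝ (SmoothFn d M) :=
  inferInstanceAs (Module ℝ C^∞⟮𝓡 d, M; 𝓘(ℝ, ℝ), ℝ⟯)

instance : FunLike (SmoothFn d M) M ℝ :=
  inferInstanceAs (FunLike C^∞⟮𝓡 d, M; 𝓘(ℝ, ℝ), ℝ⟯ M ℝ)

theorem SmoothFn.contMDiff (f : SmoothFn d M) : ContMDiff (𝓡 d) 𝓘(ℝ, ℝ) ∞ f :=
  ContMDiffMap.contMDiff f

theorem SmoothFn.mdiff (f : SmoothFn d M) (x : M) : MDifferentiableAt (𝓡 d) 𝓘(ℝ, ℝ) f x :=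
  f.contMDiff.mdifferentiable (by simp) x

theorem gradient_add (f h : SmoothFn d M) (x : M) :
    gradient d (f + h : SmoothFn d M) x = gradient d f x + gradient d h x := by
  have : differential d (f + h : SmoothFn d M) x = differential d f x + differential d h x :=
    ((f.mdiff x).hasMFDerivAt.add (h.mdiff x).hasMFDerivAt).mfderiv
  rw [gradient, gradient, gradient, this, map_add]

theorem gradient_smul (r : ℝ) (f : SmoothFn d M) (x : M) :
    gradient d (r • f : SmoothFn d M) x = r • gradient d f x := by
  have : differential d (r • f : SmoothFn d M) x = r • differential d f x :=
    ((f.mdiff x).hasMFDerivAt.const_smul r).mfderiv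
  rw [gradient, gradient, this]
  simp

/-- The `W^{1,2}` inner product `∫_M f h + ⟨∇f, ∇h⟩`. -/
def SmoothFn.inner (f h : SmoothFn d M) : ℝ :=
  ∫ x, (f x * h x + Inner.inner ℝ (gradient d f x) (gradient d h x)) ∂(riemVolume d M)

theorem SmoothFn.integrable_mul (f h : SmoothFn d M) :
    Integrable (fun x => f x * h x) (riemVolume d M) :=
  (f.contMDiff.continuous.mul h.contMDiff.continuous).integrable_of_hasCompactSupport
    (HasCompactSupport.of_compactSpace _)

theorem SmoothFn.integrable_gradient (f h : SmoothFn d M) :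
    Integrable (fun x => (Inner.inner ℝ (gradient d f x) (gradient d h x) : ℝ)) (riemVolume d M) :=
  (continuous_inner_gradient f.contMDiff h.contMDiff).integrable_of_hasCompactSupport
    (HasCompactSupport.of_compactSpace _)

theorem SmoothFn.integrable_inner (f h : SmoothFn d M) :
    Integrable (fun x => f x * h x + (Inner.inner ℝ (gradient d f x) (gradient d h x) : ℝ))
      (riemVolume d M) :=
  (f.integrable_mul h).add (f.integrable_gradient h)

/-- The `W^{1,2}` inner product as a positive semidefinite form. -/
@[reducible]
def sobolevCore : PreInnerProductSpace.Core ℝ (SmoothFn d M) where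
  inner := SmoothFn.inner
  conj_inner_symm f h := by
    simp only [SmoothFn.inner, conj_trivial]
    congr 1; funext x
    rw [mul_comm, real_inner_comm]
  re_inner_nonneg f := integral_nonneg fun x =>
    add_nonneg (mul_self_nonneg _) real_inner_self_nonneg
  add_left f g h := by
    rw [SmoothFn.inner, SmoothFn.inner, SmoothFn.inner,
      ← integral_add (f.integrable_inner h) (g.integrable_inner h)]
    congr 1; funext x
    rw [gradient_add, inner_add_left]
    change (f x + g x) * h x + _ = _
    ring
  smul_left f g r := by
    rw [SmoothFn.inner, SmoothFn.inner, conj_trivial, ← integral_const_mul]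
    congr 1; funext x
    rw [gradient_smul, real_inner_smul_left]
    change (r * f x) * g x + _ = _
    ring

instance : SeminormedAddCommGroup (SmoothFn d M) :=
  @InnerProductSpace.Core.toSeminormedAddCommGroup ℝ _ _ _ _ sobolevCore

instance : InnerProductSpace ℝ (SmoothFn d M) := InnerProductSpace.ofCore sobolevCore

variable (d M) in
/-- The Sobolev space `W^{1,2}(M)`: the completion of `C^∞(M)` for the norm
`‖f‖² = ∫_M f² + |∇f|²`. -/
abbrev W12 : Type _ := UniformSpace.Completion (SmoothFn d M)

/-- A smooth function as a continuous function. -/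
def SmoothFn.toC (f : SmoothFn d M) : C(M, ℝ) := ⟨f, f.contMDiff.continuous⟩

theorem SmoothFn.norm_sq (f : SmoothFn d M) :
    ‖f‖ ^ 2 = ∫ x, (f x * f x + Inner.inner ℝ (gradient d f x) (gradient d f x))
      ∂(riemVolume d M) := by
  rw [← real_inner_self_eq_norm_sq]; rfl

theorem SmoothFn.norm_toLp_sq (f : SmoothFn d M) :
    ‖ContinuousMap.toLp (E := ℝ) 2 (riemVolume d M) ℝ f.toC‖ ^ 2 =
      ∫ x, f x * f x ∂(riemVolume d M) := by
  rw [← real_inner_self_eq_norm_sq, L2.inner_def]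
  refine integral_congr_ae ?_
  filter_upwards [ContinuousMap.coeFn_toLp (p := 2) (𝕜 := ℝ) (riemVolume d M) f.toC] with x hx
  rw [hx]; rfl

/-- The inclusion `C^∞(M) → L²(M)`, bounded by `1` for the `W^{1,2}` norm. -/
def SmoothFn.toL2 : SmoothFn d M →L[ℝ] Lp ℝ 2 (riemVolume d M) :=
  LinearMap.mkContinuous
    { toFun := fun f => ContinuousMap.toLp (E := ℝ) 2 (riemVolume d M) ℝ f.toC
      map_add' := fun f g => map_add (ContinuousMap.toLp (E := ℝ) 2 (riemVolume d M) ℝ) f.toC g.toC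
      map_smul' := fun r f => map_smul (ContinuousMap.toLp (E := ℝ) 2 (riemVolume d M) ℝ) r f.toC }
    1 fun f => by
      rw [one_mul]
      refine le_of_sq_le_sq ?_ (norm_nonneg _)
      rw [f.norm_sq]
      refine (f.norm_toLp_sq).trans_le ?_
      refine integral_mono (f.integrable_mul f) (f.integrable_inner f) fun x => ?_
      exact le_add_of_nonneg_right real_inner_self_nonneg

/-- The inclusion `W^{1,2}(M) → L²(M)`; it gives the function on `M` underlying `u ∈ W^{1,2}(M)`. -/
def W12.toL2 : W12 d M →L[ℝ] Lp ℝ 2 (riemVolume d M) :=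
  SmoothFn.toL2.extend (UniformSpace.Completion.toComplL : SmoothFn d M →L[ℝ] W12 d M)

theorem W12.toL2_coe (f : SmoothFn d M) :
    W12.toL2 (f : W12 d M) = ContinuousMap.toLp (E := ℝ) 2 (riemVolume d M) ℝ f.toC :=
  ContinuousLinearMap.extend_eq _ UniformSpace.Completion.denseRange_coe
    (UniformSpace.Completion.isUniformInducing_coe _) f

/-- The Dirichlet energy `∫_M |∇u|² = ‖u‖²_{W^{1,2}} - ‖u‖²_{L²}`: the continuous extension to
`W^{1,2}(M)` of `f ↦ ∫_M |∇f|²`, see `W12.dirichlet_coe`. -/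
def W12.dirichlet (u : W12 d M) : ℝ := ‖u‖ ^ 2 - ‖W12.toL2 u‖ ^ 2

theorem W12.continuous_dirichlet : Continuous (W12.dirichlet : W12 d M → ℝ) :=
  (continuous_norm.pow 2).sub (W12.toL2.continuous.norm.pow 2)

theorem W12.dirichlet_coe (f : SmoothFn d M) :
    W12.dirichlet (f : W12 d M) = ∫ x, ‖gradient d f x‖ ^ 2 ∂(riemVolume d M) := by
  rw [W12.dirichlet, UniformSpace.Completion.norm_coe, W12.toL2_coe, f.norm_sq, f.norm_toLp_sq,
    integral_add (f.integrable_mul f) (f.integrable_gradient f), add_sub_cancel_left]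
  simp only [real_inner_self_eq_norm_sq]

/-- `∫_M u`, for `u ∈ W^{1,2}(M)`. -/
def W12.mean (u : W12 d M) : ℝ := ∫ x, W12.toL2 u x ∂(riemVolume d M)

/-- The Allen-Cahn energy `E_ε(u) = ∫_M ε/2 |∇u|² + W(u)/ε`, with values in `[0, ∞]`. -/
def energy (W : ℝ → ℝ) (ε : ℝ) (u : W12 d M) : ℝ≥0∞ :=
  ENNReal.ofReal (ε / 2 * W12.dirichlet u) +
    ∫⁻ x, ENNReal.ofReal (W (W12.toL2 u x) / ε) ∂(riemVolume d M)

variable (d M) in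
/-- The family `𝓕_p`: compact invariant subsets of `W^{1,2}(M) \ {0}` of index at least `p + 1`. -/
def familyF (p : ℕ) : Set (Set (W12 d M)) := Z2Index.compactSymmetric (W12 d M) (p + 1)

variable (d M) in
/-- The family `𝓖_p`: those members of `𝓕_p` all of whose elements have integral zero. -/
def familyG (p : ℕ) : Set (Set (W12 d M)) :=
  {A | A ∈ familyF d M p ∧ ∀ u ∈ A, W12.mean u = 0}

variable (d M) in
/-- `c(ε, p) = (2σ)⁻¹ inf_{A ∈ 𝓕_p} sup_{u ∈ A} E_ε(u)`; the infimum of the empty family is `∞`. -/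
def cEps (W : ℝ → ℝ) (ε : ℝ) (p : ℕ) : ℝ≥0∞ :=
  ENNReal.ofReal (1 / (2 * sigma W)) * ⨅ A ∈ familyF d M p, ⨆ u ∈ A, energy W ε u

variable (d M) in
/-- `c̃(ε, p) = (2σ)⁻¹ inf_{A ∈ 𝓖_p} sup_{u ∈ A} E_ε(u)`. -/
def cTildeEps (W : ℝ → ℝ) (ε : ℝ) (p : ℕ) : ℝ≥0∞ :=
  ENNReal.ofReal (1 / (2 * sigma W)) * ⨅ A ∈ familyG d M p, ⨆ u ∈ A, energy W ε u

variable (d M) in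
/-- The phase transition spectrum `c(p) = liminf_{ε → 0⁺} c(ε, p)`. -/
def c (W : ℝ → ℝ) (p : ℕ) : ℝ≥0∞ :=
  Filter.liminf (fun ε => cEps d M W ε p) (𝓝[>] 0)

variable (d M) in
/-- The phase transition half-volume spectrum `c̃(p) = liminf_{ε → 0⁺} c̃(ε, p)`. -/
def cTilde (W : ℝ → ℝ) (p : ℕ) : ℝ≥0∞ :=
  Filter.liminf (fun ε => cTildeEps d M W ε p) (𝓝[>] 0)

end Manifold

end AllenCahn

end

/-!
The inequality holds already for each `ε`: if `A` belongs to `𝓕_{p+1}`, then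
`B = {u ∈ A | ∫ u = 0}` belongs to `𝓖_p`, and the supremum of the energy over `B` is at most the one
over `A`. As `u ↦ ∫ u` is odd and continuous on `W^{1,2}(M)`, this amounts to the fact that the zero
set `B` of an odd continuous function `h` on a compact symmetric set `A` satisfies
`ind B ≥ ind A - 1` (`le_index_zeroSet`).

Let `w = f^* μ` be the characteristic class of the double cover of `A / (ℤ/2)`. If `w ^ j` restricts
to zero on `B / (ℤ/2)`, then `w ^ (j + 1) = w ^ j ∪ w` is zero, because the first factor vanishes
near `B / (ℤ/2)`, the second one vanishes away from it, and a cup product of cochains is locally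
zero where one of the factors is (`cup_eq_zero_of_vanishesNear`).

* The first factor vanishes near `B / (ℤ/2)` by tautness of Alexander-Spanier cohomology. Only powers
  of a degree one class are needed, and for these the chain homotopy between the identity and
  a discontinuous nearest point retraction reduces to the choice of a good cocycle
  representing `w` (`exists_vanishesNear_of_pullback_pow_eq_zero`).
* Where `h ≠ 0`, the choice of the point with `h > 0` in each orbit is a continuous section, so
  that the classifying map lifts to `S^∞` (`exists_vanishesNear_of_odd`). By compactness the lift
  has values in a sphere `Sᵐ`, which is contractible in `Sᵐ⁺¹`
  (`exists_skeleton_of_isCompact`), and a null-homotopic map is zero on degree one cohomology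
  (`pullback_one_eq_zero_of_homotopy_const`). The last point is proved by summing a cocycle
  along fine dyadic subdivisions of the paths of the homotopy.
-/

noncomputable section

/-! ### Cochains vanishing near a point -/

namespace AlexanderSpanier

section Cochains

variable {X Y Z : Type*} [TopologicalSpace X] [TopologicalSpace Y] [TopologicalSpace Z]

/-- The cochain `φ` vanishes on all tuples of points sufficiently close to `p`. -/
def VanishesNear {n : ℕ} (φ : Cochain X n) (p : X) : Prop :=
  ∃ U ∈ 𝓝 p, ∀ x : Fin (n + 1) → X, (∀ i, x i ∈ U) → φ x = 0

/-- The map `G` need not be continuous away from `p`. -/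
theorem VanishesNear.comp {n : ℕ} {φ : Cochain Y n} {G : X → Y} {p : X} {y : Y}
    (hφ : VanishesNear φ y) (hG : Filter.Tendsto G (𝓝 p) (𝓝 y)) :
    VanishesNear (pullbackCochain G n φ) p := by
  obtain ⟨U, hU, h⟩ := hφ
  exact ⟨G ⁻¹' U, hG hU, fun x hx => h _ hx⟩

theorem mk_eq_zero_iff {n : ℕ} (φ : cocycles X n) : mk φ = 0 ↔ φ.1 ∈ coboundaries X n :=
  (QuotientAddGroup.eq_zero_iff φ).trans AddSubgroup.mem_addSubgroupOf

theorem mk_eq_mk_iff {n : ℕ} (φ ψ : cocycles X n) :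
    mk φ = mk ψ ↔ φ.1 - ψ.1 ∈ coboundaries X n := by
  rw [← sub_eq_zero]
  exact mk_eq_zero_iff (φ - ψ)

theorem coboundary_zero_apply (c : Cochain X 0) (x : Fin 2 → X) :
    coboundary c x = c (fun _ => x 0) + c (fun _ => x 1) := by
  change (∑ i : Fin 2, c fun j => x (i.succAbove j)) = _
  rw [Fin.sum_univ_two, add_comm]
  congr 2 <;> · funext j; fin_cases j; rfl

theorem coboundary_one_apply (φ : Cochain X 1) (x : Fin 3 → X) :
    coboundary φ x = φ ![x 1, x 2] + φ ![x 0, x 2] + φ ![x 0, x 1] := by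
  change (∑ i : Fin 3, φ fun j => x (i.succAbove j)) = _
  rw [Fin.sum_univ_three]
  congr 3 <;> · funext j; fin_cases j <;> rfl

theorem coboundary_mem_cocycles (c : Cochain X 0) :
    coboundary c ∈ cocycles X 1 := by
  have : coboundary (coboundary c) = 0 := by
    funext x
    rw [coboundary_one_apply, coboundary_zero_apply, coboundary_zero_apply, coboundary_zero_apply]
    simp only [Matrix.cons_val_zero, Matrix.cons_val_one, Pi.zero_apply]
    generalize c _ = a, c _ = b, c _ = d
    revert a b d; decide
  change coboundary (coboundary c) ∈ locallyZero X 2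
  rw [this]
  exact zero_mem _

theorem coboundary_mem_coboundaries {n : ℕ} (c : Cochain X n) :
    coboundary c ∈ coboundaries X (n + 1) :=
  AddSubgroup.mem_sup_right ⟨c, rfl⟩

/-- A coboundary on `Y`, pulled back along a map which need not be continuous, differs from a
coboundary by the pullback of a locally zero cochain. -/
theorem exists_locallyZero_add_of_mem_coboundaries {n : ℕ} {φ : Cochain Y n}
    (hφ : φ ∈ coboundaries Y n) (G : X → Y) :
    ∃ ζ ∈ locallyZero Y n, ∃ D ∈ coboundaries X n,
      pullbackCochain G n φ = pullbackCochain G n ζ + D := by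
  cases n with
  | zero => exact ⟨φ, hφ, 0, zero_mem _, (add_zero _).symm⟩
  | succ n =>
    obtain ⟨ζ, hζ, _, ⟨χ, rfl⟩, rfl⟩ := AddSubgroup.mem_sup.1 hφ
    exact ⟨ζ, hζ, _, coboundary_mem_coboundaries (pullbackCochain G n χ), map_add _ _ _⟩

/-- The cochain-level power `φ ∪ ⋯ ∪ φ` of a `1`-cochain. -/
def powCochain (φ : Cochain X 1) : (k : ℕ) → Cochain X k
  | 0 => fun _ => 1
  | k + 1 => cupCochain (powCochain φ k) φ

theorem exists_pow_mk (φ : cocycles X 1) (k : ℕ) :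
    ∃ h : powCochain φ.1 k ∈ cocycles X k, pow (mk φ) k = mk ⟨powCochain φ.1 k, h⟩ := by
  induction k with
  | zero => exact ⟨_, rfl⟩
  | succ k ih =>
    obtain ⟨h, e⟩ := ih
    exact ⟨cupCochain_mem_cocycles h φ.2, by rw [pow, e, cup_mk]; rfl⟩

theorem powCochain_congr {φ : Cochain X 1} {φ' : Cochain Y 1} {g : X → Y} {V : Set X}
    (h : ∀ x : Fin 2 → X, (∀ i, x i ∈ V) → φ x = φ' fun i => g (x i)) (k : ℕ)
    (x : Fin (k + 1) → X) (hx : ∀ i, x i ∈ V) :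
    powCochain φ k x = powCochain φ' k fun i => g (x i) := by
  induction k with
  | zero => rfl
  | succ k ih =>
    simp only [powCochain, cupCochain]
    rw [ih _ fun i => hx _, h _ fun i => hx _]

theorem pullback_pow (f : C(X, Y)) (a : H Y 1) (k : ℕ) :
    pullback f k (pow a k) = pow (pullback f 1 a) k := by
  obtain ⟨φ, rfl⟩ := QuotientAddGroup.mk_surjective a
  induction k with
  | zero => rfl
  | succ k ih =>
    have h1 : pullback f (k + 1) (cup (pow (mk φ) k) (mk φ)) =
        cup (pullback f k (pow (mk φ) k)) (pullback f 1 (mk φ)) := by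
      obtain ⟨_, e⟩ := exists_pow_mk φ k
      rw [e]; rfl
    exact h1.trans (by rw [show pullback f k (pow (mk φ) k) = _ from ih]; rfl)

theorem pullback_comp (f : C(Y, Z)) (g : C(X, Y)) (k : ℕ) (a : H Z k) :
    pullback (f.comp g) k a = pullback g k (pullback f k a) := by
  obtain ⟨φ, rfl⟩ := QuotientAddGroup.mk_surjective a
  rfl

/-- The cup product of two classes is zero if every point has a neighbourhood on which one of their
representatives vanishes: the cup product of the cochains is then locally zero. The cochain `P'`
representing the first class only has to differ from a cocycle `P` by a coboundary cochain, and
need not be shown to be a cocycle itself. -/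
theorem cup_eq_zero_of_vanishesNear {p q : ℕ} (P : cocycles X p) (Q : cocycles X q)
    {P' : Cochain X p} (hP : P.1 - P' ∈ coboundaries X p)
    (h : ∀ x, VanishesNear P' x ∨ VanishesNear Q.1 x) : cup (mk P) (mk Q) = 0 := by
  rw [cup_mk, mk_eq_zero_iff]
  have h0 : cupCochain P' Q.1 ∈ locallyZero X (p + q) := by
    intro x
    rcases h x with ⟨U, hU, h⟩ | ⟨U, hU, h⟩
    · exact ⟨U, hU, fun y hy => by rw [cupCochain, h _ fun _ => hy _, zero_mul]⟩
    · exact ⟨U, hU, fun y hy => by rw [cupCochain, h _ fun _ => hy _, mul_zero]⟩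
  have := add_mem (cupCochain_mem_of_left hP Q.2) (locallyZero_le_coboundaries _ h0)
  rwa [← add_cupCochain, sub_add_cancel] at this

/-- If a map `f` factors through `e : Y → Z` by a map `G` which need not be continuous, and
`e^* μ = 0`, then `f^* μ` is represented by a cocycle which vanishes near all points of
continuity of `G`. -/
theorem exists_vanishesNear_of_factor (f : C(X, Z)) (e : C(Y, Z)) (G : X → Y)
    (hG : ∀ x, f x = e (G x)) (μ : H Z 1) (hμ : pullback e 1 μ = 0) :
    ∃ φ : cocycles X 1, mk φ = pullback f 1 μ ∧ ∀ p, ContinuousAt G p → VanishesNear φ.1 p := by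
  obtain ⟨m, rfl⟩ := QuotientAddGroup.mk_surjective μ
  obtain ⟨ζ, hζ, _, ⟨χ, rfl⟩, h⟩ := AddSubgroup.mem_sup.1 ((mk_eq_zero_iff _).1 hμ)
  have h : ζ + coboundary χ = pullbackCochain e 1 m.1 := h
  have hφ : pullbackCochain f 1 m.1 = pullbackCochain G 1 ζ +
      coboundary (pullbackCochain G 0 χ) := by
    rw [coboundary_pullbackCochain, ← map_add, h]
    funext x
    exact congrArg m.1 (funext fun i => hG (x i))
  refine ⟨⟨pullbackCochain f 1 m.1 - coboundary (pullbackCochain G 0 χ),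
    sub_mem (pullbackCochain_cocycles f m.2) (coboundary_mem_cocycles _)⟩, ?_, fun p hp => ?_⟩
  · refine (mk_eq_mk_iff _ ⟨pullbackCochain f 1 m.1, pullbackCochain_cocycles f m.2⟩).2 ?_
    change pullbackCochain f 1 m.1 - _ - pullbackCochain f 1 m.1 ∈ _
    rw [sub_sub_cancel_left]
    exact neg_mem (coboundary_mem_coboundaries _)
  · change VanishesNear (pullbackCochain f 1 m.1 - coboundary (pullbackCochain G 0 χ)) p
    rw [hφ, add_sub_cancel_right]
    exact VanishesNear.comp (hζ (G p)) hp

/-- A form of tautness for powers of a degree one class. The map `r` is a retraction onto the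
image of `i` which is only continuous along that image. The cocycle `φ` is replaced by
`φ + δc` with `c x = φ (x, i (r x))`, which near the image of `i` is equal to `φ` composed with
`i ∘ r`; its powers are then equal there to pullbacks along `r` of cochains on `Y`. -/
theorem exists_vanishesNear_of_pullback_pow_eq_zero (i : C(Y, X)) (r : X → Y)
    (hr : ∀ y, Filter.Tendsto r (𝓝 (i y)) (𝓝 y)) (w : H X 1) (j : ℕ)
    (h : pullback i j (pow w j) = 0) :
    ∃ P : cocycles X j, mk P = pow w j ∧ ∃ P' : Cochain X j, P.1 - P' ∈ coboundaries X j ∧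
      ∀ y, VanishesNear P' (i y) := by
  obtain ⟨φ, rfl⟩ := QuotientAddGroup.mk_surjective w
  -- On a small set containing `x`, `x'`, `i (r x)` and `i (r x')`, two applications of the cocycle
  -- identity give `φ (x, x') + c x + c x' = φ (i (r x), i (r x'))`.
  let c : Cochain X 0 := fun x => φ.1 ![x 0, i (r (x 0))]
  let φ' : cocycles X 1 := ⟨φ.1 + coboundary c, add_mem φ.2 (coboundary_mem_cocycles c)⟩
  have hφ' : mk φ' = mk φ := by
    rw [mk_eq_mk_iff]
    change φ.1 + coboundary c - φ.1 ∈ _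
    rw [add_sub_cancel_left]
    exact coboundary_mem_coboundaries c
  have hnear : ∀ y, ∃ V ∈ 𝓝 (i y), ∀ x : Fin 2 → X, (∀ k, x k ∈ V) →
      φ'.1 x = φ.1 fun k => i (r (x k)) := by
    intro y
    obtain ⟨V, hV, hφV⟩ := φ.2 (i y)
    have hir : Filter.Tendsto (fun x => i (r x)) (𝓝 (i y)) (𝓝 (i y)) :=
      (i.continuous.tendsto y).comp (hr y)
    refine ⟨V ∩ (fun x => i (r x)) ⁻¹' V, Filter.inter_mem hV (hir hV), fun x hx => ?_⟩
    have h1 := hφV ![x 0, x 1, i (r (x 1))] (by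
      intro k; fin_cases k
      exacts [(hx 0).1, (hx 1).1, (hx 1).2])
    have h2 := hφV ![x 0, i (r (x 0)), i (r (x 1))] (by
      intro k; fin_cases k
      exacts [(hx 0).1, (hx 0).2, (hx 1).2])
    rw [coboundary_one_apply] at h1 h2
    change φ.1 x + coboundary c x = _
    rw [coboundary_zero_apply]
    have e1 : x = ![x 0, x 1] := by funext k; fin_cases k <;> rfl
    have e2 : (fun k => i (r (x k))) = ![i (r (x 0)), i (r (x 1))] := by
      funext k; fin_cases k <;> rfl
    rw [e2]
    conv_lhs => rw [e1]
    simp only [c, Matrix.cons_val_zero, Matrix.cons_val_one, Matrix.cons_val] at h1 h2 ⊢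
    generalize φ.1 ![x 0, x 1] = a1 at *
    generalize φ.1 ![x 0, i (r (x 0))] = a2 at *
    generalize φ.1 ![x 1, i (r (x 1))] = a3 at *
    generalize φ.1 ![i (r (x 0)), i (r (x 1))] = a4 at *
    generalize φ.1 ![x 0, i (r (x 1))] = a5 at *
    clear * - h1 h2
    revert a1 a2 a3 a4 a5; decide
  change pullback i j (pow (mk φ) j) = 0 at h
  change ∃ P : cocycles X j, mk P = pow (mk φ) j ∧ _
  obtain ⟨_, e⟩ := exists_pow_mk φ j
  obtain ⟨hc', e'⟩ := exists_pow_mk φ' j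
  rw [e] at h
  obtain ⟨ζ, hζ, D, hD, hζD⟩ :=
    exists_locallyZero_add_of_mem_coboundaries ((mk_eq_zero_iff _).1 h) r
  refine ⟨⟨_, hc'⟩, by rw [← e', hφ'], powCochain φ'.1 j - D, ?_, fun y => ?_⟩
  · rwa [sub_sub_cancel]
  · obtain ⟨V, hV, hφV⟩ := hnear y
    obtain ⟨U, hU, hζU⟩ := VanishesNear.comp (hζ y) (hr y)
    refine ⟨U ∩ V, Filter.inter_mem hU hV, fun x hx => ?_⟩
    have h3 := powCochain_congr (g := fun x => i (r x)) hφV j x fun k => (hx k).2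
    have h4 := congrFun hζD x
    rw [Pi.add_apply, hζU x fun k => (hx k).1, zero_add] at h4
    rw [Pi.sub_apply, h3, ← h4]
    exact sub_self _

end Cochains

end AlexanderSpanier

/-! ### Homotopy invariance in degree one -/

namespace AlexanderSpanier

section Homotopy

variable {Y Z : Type*} [TopologicalSpace Y] [TopologicalSpace Z]

/-- The `1`-cochain `m` is additive on all triples of points of `U`. -/
def AdditiveOn (m : Cochain Z 1) (U : Set Z) : Prop :=
  ∀ a ∈ U, ∀ b ∈ U, ∀ c ∈ U, m ![a, b] + m ![b, c] = m ![a, c]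

theorem exists_additiveOn_of_mem_cocycles {m : Cochain Z 1} (hm : m ∈ cocycles Z 1) (z : Z) :
    ∃ U ∈ 𝓝 z, AdditiveOn m U := by
  obtain ⟨U, hU, h⟩ := hm z
  refine ⟨U, hU, fun a ha b hb c hc => ?_⟩
  have h1 := h ![a, b, c] (by intro k; fin_cases k; exacts [ha, hb, hc])
  rw [coboundary_one_apply] at h1
  simp only [Matrix.cons_val_zero, Matrix.cons_val_one, Matrix.cons_val] at h1
  generalize m ![a, b] = x, m ![b, c] = y, m ![a, c] = z at *
  clear * - h1
  revert x y z; decide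

theorem AdditiveOn.self {m : Cochain Z 1} {U : Set Z} (h : AdditiveOn m U) {z : Z} (hz : z ∈ U) :
    m ![z, z] = 0 := by
  simpa using h z hz z hz z hz

/-- Compactness of `[0, 1]` gives a neighbourhood of `y` which works for all sufficiently
fine dyadic subdivisions. -/
theorem exists_additiveOn_dyadic {m : Cochain Z 1} (hm : m ∈ cocycles Z 1) (G : C(Y × ℝ, Z))
    (y : Y) :
    ∃ V ∈ 𝓝 y, ∃ K : ℕ, ∀ k ≥ K, ∀ i : ℕ, i < 2 ^ k → ∃ U,
      AdditiveOn m U ∧ ∀ x ∈ V,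
      ∀ t ∈ Set.Icc ((i : ℝ) / 2 ^ k) ((i + 1) / 2 ^ k), G (x, t) ∈ U := by
  have key : ∃ V ∈ 𝓝 y, ∃ δ > 0, ∀ t ∈ Set.Icc (0 : ℝ) 1, ∃ U, AdditiveOn m U ∧
      ∀ x ∈ V, ∀ s ∈ Metric.ball t δ, G (x, s) ∈ U := by
    refine (isCompact_Icc (a := (0 : ℝ)) (b := 1)).induction_on
      (p := fun S => ∃ V ∈ 𝓝 y, ∃ δ > 0, ∀ t ∈ S, ∃ U, AdditiveOn m U ∧
        ∀ x ∈ V, ∀ s ∈ Metric.ball t δ, G (x, s) ∈ U) ?_ ?_ ?_ ?_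
    · exact ⟨Set.univ, Filter.univ_mem, 1, one_pos, fun t ht => ht.elim⟩
    · rintro S T hST ⟨V, hV, δ, hδ, h⟩
      exact ⟨V, hV, δ, hδ, fun t ht => h t (hST ht)⟩
    · rintro S T ⟨V, hV, δ, hδ, h⟩ ⟨V', hV', δ', hδ', h'⟩
      refine ⟨V ∩ V', Filter.inter_mem hV hV', min δ δ', lt_min hδ hδ', ?_⟩
      rintro t (ht | ht)
      · obtain ⟨U, hU, hG⟩ := h t ht
        exact ⟨U, hU, fun x hx s hs =>
          hG x hx.1 s (Metric.ball_subset_ball (min_le_left _ _) hs)⟩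
      · obtain ⟨U, hU, hG⟩ := h' t ht
        exact ⟨U, hU, fun x hx s hs =>
          hG x hx.2 s (Metric.ball_subset_ball (min_le_right _ _) hs)⟩
    · intro t _
      obtain ⟨U, hU, hmU⟩ := exists_additiveOn_of_mem_cocycles hm (G (y, t))
      obtain ⟨V, hV, B, hB, hVB⟩ := mem_nhds_prod_iff.1 (G.continuous.continuousAt hU)
      obtain ⟨ε, hε, hεB⟩ := Metric.mem_nhds_iff.1 hB
      refine ⟨Metric.ball t (ε / 2), mem_nhdsWithin_of_mem_nhds
        (Metric.ball_mem_nhds t (half_pos hε)), V, hV, ε / 2, half_pos hε, fun s hs =>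
        ⟨U, hmU, fun x hx s' hs' => hVB ⟨hx, hεB ?_⟩⟩⟩
      rw [Metric.mem_ball] at hs hs' ⊢
      linarith [dist_triangle s' s t]
  obtain ⟨V, hV, δ, hδ, h⟩ := key
  obtain ⟨K, hK⟩ := exists_pow_lt_of_lt_one hδ (show (1 / 2 : ℝ) < 1 by norm_num)
  refine ⟨V, hV, K, fun k hk i hi => ?_⟩
  have h2k : (0 : ℝ) < 2 ^ k := by positivity
  have hi' : (i : ℝ) ≤ 2 ^ k := by exact_mod_cast hi.le
  obtain ⟨U, hU, hG⟩ := h (i / 2 ^ k) ⟨by positivity, (div_le_one h2k).2 hi'⟩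
  refine ⟨U, hU, fun x hx t ht => hG x hx t ?_⟩
  have hk' : (1 / 2 : ℝ) ^ k ≤ (1 / 2) ^ K :=
    pow_le_pow_of_le_one (by norm_num) (by norm_num) hk
  rw [one_div, inv_pow, inv_pow] at hk'
  rw [one_div, inv_pow] at hK
  rw [Metric.mem_ball, Real.dist_eq, abs_of_nonneg (sub_nonneg.2 ht.1)]
  have := ht.2
  rw [add_div, one_div] at this
  linarith

theorem sum_range_two_mul {A : Type*} [AddCommMonoid A] (f : ℕ → A) (n : ℕ) :
    ∑ i ∈ Finset.range (2 * n), f i = ∑ i ∈ Finset.range n, (f (2 * i) + f (2 * i + 1)) := by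
  induction n with
  | zero => rfl
  | succ n ih =>
    rw [show 2 * (n + 1) = 2 * n + 1 + 1 by ring, Finset.sum_range_succ, Finset.sum_range_succ, ih,
      Finset.sum_range_succ, add_assoc]

/-- The sum of the values of a `1`-cochain along the `k`-th dyadic subdivision of the
path `t ↦ G (y, t)`. -/
def dyadicSum (m : Cochain Z 1) (G : C(Y × ℝ, Z)) (k : ℕ) (y : Y) : ZMod 2 :=
  ∑ i ∈ Finset.range (2 ^ k), m ![G (y, (i : ℝ) / 2 ^ k), G (y, ((i : ℝ) + 1) / 2 ^ k)]

theorem left_mem_Icc_dyadic (i k : ℕ) :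
    (i : ℝ) / 2 ^ k ∈ Set.Icc ((i : ℝ) / 2 ^ k) ((i + 1) / 2 ^ k) :=
  ⟨le_rfl, by gcongr; linarith⟩

theorem right_mem_Icc_dyadic (i k : ℕ) :
    ((i : ℝ) + 1) / 2 ^ k ∈ Set.Icc ((i : ℝ) / 2 ^ k) ((i + 1) / 2 ^ k) :=
  ⟨by gcongr; linarith, le_rfl⟩

/-- The dyadic sums of a cocycle are eventually constant, so that they have a limit. -/
theorem exists_eventually_dyadicSum_eq {m : Cochain Z 1} (hm : m ∈ cocycles Z 1)
    (G : C(Y × ℝ, Z)) (y : Y) : ∃ v, ∀ᶠ k in Filter.atTop, dyadicSum m G k y = v := by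
  obtain ⟨V, hV, K, hK⟩ := exists_additiveOn_dyadic hm G y
  have hy := mem_of_mem_nhds hV
  refine ⟨dyadicSum m G K y, Filter.eventually_atTop.2 ⟨K, fun k hk => ?_⟩⟩
  induction k, hk using Nat.le_induction with
  | base => rfl
  | succ k hk ih =>
    rw [← ih, dyadicSum, dyadicSum, pow_succ', sum_range_two_mul]
    refine Finset.sum_congr rfl fun i hi => ?_
    obtain ⟨U, hU, hG⟩ := hK k hk i (Finset.mem_range.1 hi)
    have e1 : ((2 * i : ℕ) : ℝ) / 2 ^ (k + 1) = i / 2 ^ k := by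
      push_cast; rw [pow_succ]; field_simp
    have e2 : (((2 * i + 1 : ℕ) : ℝ) + 1) / 2 ^ (k + 1) = (i + 1) / 2 ^ k := by
      push_cast; rw [pow_succ]; field_simp; ring
    have e3 : (((2 * i : ℕ) : ℝ) + 1) / 2 ^ (k + 1) = ((2 * i + 1 : ℕ) : ℝ) / 2 ^ (k + 1) := by
      push_cast; rfl
    rw [e1, e2, e3]
    refine hU _ (hG y hy _ (left_mem_Icc_dyadic i k)) _ (hG y hy _ ⟨?_, ?_⟩) _
      (hG y hy _ (right_mem_Icc_dyadic i k))
    · rw [← e1]; gcongr; simp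
    · rw [← e2]; gcongr; simp

/-- A cocycle is locally additive, so the sum over the small squares of the strip between two
neighbouring paths telescopes: the dyadic sums along the long sides differ by the values of the
cocycle on the two ends. -/
theorem exists_eventually_dyadicSum_add_eq {m : Cochain Z 1} (hm : m ∈ cocycles Z 1)
    (G : C(Y × ℝ, Z)) (y : Y) : ∃ V ∈ 𝓝 y, ∀ᶠ k in Filter.atTop, ∀ x ∈ V, ∀ x' ∈ V,
      dyadicSum m G k x + dyadicSum m G k x' = m ![G (x, 1), G (x', 1)] +
        m ![G (x, 0), G (x', 0)] := by
  obtain ⟨V, hV, K, hK⟩ := exists_additiveOn_dyadic hm G y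
  refine ⟨V, hV, Filter.eventually_atTop.2 ⟨K, fun k hk x hx x' hx' => ?_⟩⟩
  have key : ∀ n ≤ 2 ^ k,
      ∑ i ∈ Finset.range n, (m ![G (x, (i : ℝ) / 2 ^ k), G (x, ((i : ℝ) + 1) / 2 ^ k)] +
        m ![G (x', (i : ℝ) / 2 ^ k), G (x', ((i : ℝ) + 1) / 2 ^ k)]) =
      m ![G (x, (n : ℝ) / 2 ^ k), G (x', (n : ℝ) / 2 ^ k)] + m ![G (x, 0), G (x', 0)] := by
    intro n hn
    induction n with
    | zero => simp [CharTwo.add_self_eq_zero]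
    | succ n ih =>
      rw [Finset.sum_range_succ, ih (by omega)]
      obtain ⟨U, hU, hG⟩ := hK k hk n (by omega)
      have hl := left_mem_Icc_dyadic n k
      have hr := right_mem_Icc_dyadic n k
      have h1 := hU _ (hG x hx _ hl) _ (hG x hx _ hr) _ (hG x' hx' _ hr)
      have h2 := hU _ (hG x hx _ hl) _ (hG x' hx' _ hl) _ (hG x' hx' _ hr)
      push_cast
      rw [← h2] at h1
      clear ih hU hG h2
      generalize m ![G (x, (n : ℝ) / 2 ^ k), G (x, ((n : ℝ) + 1) / 2 ^ k)] = a1 at *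
      generalize m ![G (x', (n : ℝ) / 2 ^ k), G (x', ((n : ℝ) + 1) / 2 ^ k)] = a2 at *
      generalize m ![G (x, (n : ℝ) / 2 ^ k), G (x', (n : ℝ) / 2 ^ k)] = a3 at *
      generalize m ![G (x, ((n : ℝ) + 1) / 2 ^ k), G (x', ((n : ℝ) + 1) / 2 ^ k)] = a4 at *
      generalize m ![G (x, 0), G (x', 0)] = a5 at *
      clear * - h1
      revert a1 a2 a3 a4 a5; decide
  have := key (2 ^ k) le_rfl
  rw [Finset.sum_add_distrib] at this
  rw [dyadicSum, dyadicSum, this]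
  simp

/-- A null-homotopic map induces zero on degree one cohomology: the limit of the dyadic sums along
the null-homotopy is a `0`-cochain whose coboundary is locally the pulled back cocycle. -/
theorem pullback_one_eq_zero_of_homotopy_const (e : C(Y, Z)) (G : C(Y × ℝ, Z)) (z : Z)
    (h0 : ∀ y, G (y, 0) = z) (h1 : ∀ y, G (y, 1) = e y) (μ : H Z 1) : pullback e 1 μ = 0 := by
  obtain ⟨m, rfl⟩ := QuotientAddGroup.mk_surjective μ
  choose ψ hψ using exists_eventually_dyadicSum_eq m.2 G
  refine (mk_eq_zero_iff ⟨pullbackCochain e 1 m.1, pullbackCochain_cocycles e m.2⟩).2 ?_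
  refine mem_coboundaries_of_eq rfl (fun x => ψ (x 0)) _ fun y => ?_
  obtain ⟨V, hV, h⟩ := exists_eventually_dyadicSum_add_eq m.2 G y
  refine ⟨V, hV, fun x hx => ?_⟩
  obtain ⟨k, hk, hk0, hk1⟩ := (h.and ((hψ (x 0)).and (hψ (x 1)))).exists
  have h2 := hk _ (hx 0) _ (hx 1)
  obtain ⟨U, hU, hmU⟩ := exists_additiveOn_of_mem_cocycles m.2 z
  rw [hk0, hk1, h1, h1, h0, h0, hmU.self (mem_of_mem_nhds hU), add_zero] at h2
  change m.1 (fun k => e (x k)) - coboundary (fun x => ψ (x 0)) x = 0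
  rw [coboundary_zero_apply, h2, sub_eq_zero]
  exact congrArg m.1 (funext fun k => by fin_cases k <;> rfl)

end Homotopy

end AlexanderSpanier

/-! ### Compact subsets and contractions in the infinite sphere -/

namespace Z2Index

open AlexanderSpanier

theorem InfSphere.sum_sq_eq_one (x : InfSphere) {s : Finset ℕ} (hs : ∀ i ∉ s, x.1 i = 0) :
    ∑ i ∈ s, x.1 i ^ 2 = 1 := by
  refine Eq.trans (Finset.sum_subset (fun i hi => ?_) fun i _ hi => ?_).symm x.2
  · by_contra h
    exact Finsupp.mem_support_iff.1 hi (hs i h)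
  · rw [Finsupp.notMem_support_iff.1 hi, zero_pow two_ne_zero]

theorem continuous_skeleton_val (m : ℕ) : Continuous fun x : Skeleton m => x.1 :=
  continuous_iSup_rng (i := m) continuous_coinduced_rng

theorem continuous_skeleton_coord (m i : ℕ) : Continuous fun x : Skeleton m => x.1.1 i :=
  (continuous_apply i).comp continuous_induced_dom

theorem continuous_coord (i : ℕ) : Continuous fun x : InfSphere => x.1 i :=
  continuous_iSup_dom.2 fun m => continuous_coinduced_dom.2 (continuous_skeleton_coord m i)

/-- A point of `S^∞` as a point of a skeleton which contains it. -/
def toSkeleton (m : ℕ) (x : InfSphere) (h : ∀ i, m < i → x.1 i = 0) : Skeleton m := ⟨x, h⟩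

theorem continuous_toSkeleton {X : Type*} [TopologicalSpace X] {m : ℕ} {F : X → InfSphere}
    (hF : ∀ i, Continuous fun x => (F x).1 i) (h : ∀ x i, m < i → (F x).1 i = 0) :
    Continuous fun x => toSkeleton m (F x) (h x) :=
  continuous_induced_rng.2 (continuous_pi hF)

instance (m : ℕ) : T1Space (Skeleton m) :=
  have : Topology.IsInducing fun x : Skeleton m => (fun i => x.1.1 i : ℕ → ℝ) := ⟨rfl⟩
  (Topology.IsEmbedding.mk this fun _ _ h =>
    Subtype.ext (Subtype.ext (DFunLike.coe_injective h))).t1Space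

/-- A compact subset of `S^∞` lies in a skeleton. Otherwise it contains points `x n` outside the
`n`-th skeleton, for all `n`. Each skeleton contains only finitely many of them, so the sets
`{x n, x (n + 1), …}` are closed in the direct limit topology, and their complements form an
increasing open cover without a finite subcover. -/
theorem exists_skeleton_of_isCompact {K : Set InfSphere} (hK : IsCompact K) :
    ∃ m, ∀ x ∈ K, ∀ i, m < i → x.1 i = 0 := by
  by_contra! hne
  choose x hxK hx using hne
  have hfin : ∀ n m, {y : Skeleton m | y.1 ∈ x '' Set.Ici n}.Finite := by
    intro n m
    refine Set.Finite.preimage (fun _ _ _ _ h => Subtype.ext h)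
      (s := {y : InfSphere | y ∈ x '' Set.Ici n ∧ ∀ i, m < i → y.1 i = 0}) ?_ |>.subset
      fun y hy => ⟨hy, y.2⟩
    refine ((Set.finite_lt_nat m).image x).subset ?_
    rintro _ ⟨⟨k, _, rfl⟩, hk⟩
    refine ⟨k, ?_, rfl⟩
    by_contra hkm
    obtain ⟨i, hi, hxi⟩ := hx k
    exact hxi (hk i (by simp only [Set.mem_ofPred_eq] at hkm; omega))
  have hopen : ∀ n, IsOpen (x '' Set.Ici n)ᶜ := by
    intro n
    refine isOpen_iSup_iff.2 fun m => isOpen_coinduced.2 ?_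
    exact (hfin n m).isClosed.isOpen_compl
  have hcover : K ⊆ ⋃ n, (x '' Set.Ici n)ᶜ := by
    intro y _
    refine Set.mem_iUnion.2 ⟨y.1.support.sup id, ?_⟩
    rintro ⟨k, hk, rfl⟩
    obtain ⟨i, hi, hxi⟩ := hx k
    exact absurd (Finset.le_sup (f := id) (Finsupp.mem_support_iff.2 hxi))
      (not_le.2 (lt_of_le_of_lt hk hi))
  obtain ⟨n, hn⟩ := hK.elim_directed_cover _ hopen hcover (directed_of_isDirected_le
    fun a b hab => Set.compl_subset_compl.2 (Set.image_mono (Set.Ici_subset_Ici.2 hab)))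
  exact hn (hxK n) ⟨n, Set.self_mem_Ici, rfl⟩

/-- The point `sin θ · x + cos θ · e_{m + 1}` of the `(m + 1)`-dimensional sphere. -/
def cone (m : ℕ) (x : Skeleton m) (θ : ℝ) : InfSphere :=
  ⟨Real.sin θ • x.1.1 + Finsupp.single (m + 1) (Real.cos θ), by
    set y := Real.sin θ • x.1.1 + Finsupp.single (m + 1) (Real.cos θ) with hy
    have hi : ∀ i ∈ Finset.range (m + 1), y i ^ 2 = Real.sin θ ^ 2 * x.1.1 i ^ 2 := by
      intro i hi
      have : m + 1 ≠ i := by rw [Finset.mem_range] at hi; omega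
      simp [hy, this, mul_pow]
    have hm : y (m + 1) = Real.cos θ := by
      simp [hy, x.2 (m + 1) (Nat.lt_succ_self m)]
    have hs : ∀ i ∉ Finset.range (m + 1), x.1.1 i = 0 := fun i hi =>
      x.2 i (by rw [Finset.mem_range] at hi; omega)
    have hsupp : y.support ⊆ Finset.range (m + 2) := by
      intro i h
      by_contra hi
      rw [Finset.mem_range] at hi
      have : m + 1 ≠ i := by omega
      refine Finsupp.mem_support_iff.1 h ?_
      simp [hy, this, x.2 i (by omega)]
    rw [Finset.sum_subset hsupp fun i _ h => by
        rw [Finsupp.notMem_support_iff.1 h, zero_pow two_ne_zero],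
      Finset.sum_range_succ, Finset.sum_congr rfl hi, hm, ← Finset.mul_sum,
      x.1.sum_sq_eq_one hs, mul_one, Real.sin_sq_add_cos_sq]⟩

theorem cone_apply (m : ℕ) (x : Skeleton m) (θ : ℝ) (i : ℕ) :
    (cone m x θ).1 i = Real.sin θ * x.1.1 i + Finsupp.single (m + 1) (1 : ℝ) i * Real.cos θ := by
  simp [cone, Finsupp.single_apply]

theorem continuous_cone (m : ℕ) :
    Continuous fun p : Skeleton m × ℝ => cone m p.1 (Real.pi / 2 * p.2) := by
  have h : ∀ p : Skeleton m × ℝ, ∀ i, m + 1 < i → (cone m p.1 (Real.pi / 2 * p.2)).1 i = 0 := by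
    intro p i hi
    have : m + 1 ≠ i := by omega
    simp [cone_apply, this, p.1.2 i (by omega)]
  refine (continuous_skeleton_val (m + 1)).comp (continuous_toSkeleton (fun i => ?_) h)
  simp only [cone_apply]
  have := (continuous_skeleton_coord m i).comp (continuous_fst (Y := ℝ))
  simp only [Function.comp_def] at this
  fun_prop

/-- The double cover `S^∞ → RP^∞`. -/
def quotientRP : C(InfSphere, RPInf) := ⟨Quotient.mk _, continuous_quotient_mk'⟩

/-- The map from the `m`-sphere to `RP^∞`. -/
def skeletonToRP (m : ℕ) : C(Skeleton m, RPInf) :=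
  quotientRP.comp ⟨fun x => x.1, continuous_skeleton_val m⟩

/-- The `m`-sphere is contractible in `S^∞`, so degree one classes of `RP^∞` die on it. -/
theorem pullback_skeletonToRP (m : ℕ) (μ : H RPInf 1) : pullback (skeletonToRP m) 1 μ = 0 := by
  let G : C(Skeleton m × ℝ, InfSphere) :=
    ⟨fun p => cone m p.1 (Real.pi / 2 * p.2), continuous_cone m⟩
  have hpole : ∑ i ∈ (Finsupp.single (m + 1) (1 : ℝ)).support,
      (Finsupp.single (m + 1) (1 : ℝ)) i ^ 2 = 1 := by
    rw [Finsupp.support_single _ one_ne_zero]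
    simp
  let z : InfSphere := ⟨_, hpole⟩
  have h0 : ∀ y, G (y, 0) = z := by
    refine fun y => Subtype.ext (Finsupp.ext fun i => ?_)
    change (cone m y (Real.pi / 2 * 0)).1 i = Finsupp.single (m + 1) (1 : ℝ) i
    rw [cone_apply]
    simp
  have h1 : ∀ y, G (y, 1) = y.1 := by
    refine fun y => Subtype.ext (Finsupp.ext fun i => ?_)
    change (cone m y (Real.pi / 2 * 1)).1 i = y.1.1 i
    rw [cone_apply]
    simp
  exact pullback_one_eq_zero_of_homotopy_const (skeletonToRP m) (quotientRP.comp G) (quotientRP z)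
    (fun y => congrArg quotientRP (h0 y)) (fun y => congrArg quotientRP (h1 y)) μ

end Z2Index

/-! ### The index of the zero set of an odd function -/

namespace Z2Index

open AlexanderSpanier

section Orbit

variable {X : Type*} [TopologicalSpace X] {τ : X → X} (hτ : Function.Involutive τ)

theorem isOpenMap_orbitMk (hc : Continuous τ) :
    IsOpenMap (Quotient.mk (orbitSetoid τ hτ)) := by
  intro U hU
  have : Quotient.mk (orbitSetoid τ hτ) ⁻¹' (Quotient.mk (orbitSetoid τ hτ) '' U) =
      U ∪ τ ⁻¹' U := by
    ext x
    constructor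
    · rintro ⟨y, hy, h⟩
      rcases Quotient.exact h with rfl | rfl
      · exact Or.inl hy
      · exact Or.inr (by rwa [Set.mem_preimage, hτ y])
    · rintro (h | h)
      · exact ⟨x, h, rfl⟩
      · exact ⟨τ x, h, Quotient.sound (Or.inr (hτ x).symm)⟩
  refine isOpen_coinduced.2 ?_
  change IsOpen (Quotient.mk (orbitSetoid τ hτ) ⁻¹' _)
  rw [this]
  exact hU.union (hU.preimage hc)

theorem out_mk_eq_or (x : X) : (Quotient.mk (orbitSetoid τ hτ) x).out = x ∨
    (Quotient.mk (orbitSetoid τ hτ) x).out = τ x :=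
  (orbitSetoid τ hτ).symm (Quotient.mk_out (s := orbitSetoid τ hτ) x)

/-- The choice of orbit representatives is not continuous, but limits can be computed at both points
of an orbit. -/
theorem tendsto_comp_out (hc : Continuous τ) {Z : Type*} {f : X → Z} {l : Filter Z} {x : X}
    (h1 : Filter.Tendsto f (𝓝 x) l) (h2 : Filter.Tendsto f (𝓝 (τ x)) l) :
    Filter.Tendsto (fun p : OrbitSpace τ hτ => f p.out) (𝓝 (Quotient.mk _ x)) l := by
  rw [← (isOpenMap_orbitMk hτ hc).map_nhds_eq continuous_quotient_mk'.continuousAt,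
    Filter.tendsto_map'_iff]
  intro O hO
  change ∀ᶠ y in 𝓝 x, f (Quotient.mk (orbitSetoid τ hτ) y).out ∈ O
  have h1' : ∀ᶠ y in 𝓝 x, f y ∈ O := h1 hO
  have h2' : ∀ᶠ y in 𝓝 x, f (τ y) ∈ O := (h2.comp (hc.tendsto x)) hO
  filter_upwards [h1', h2'] with y hy hy'
  rcases out_mk_eq_or hτ y with h | h <;> rw [h]
  exacts [hy, hy']

end Orbit

section ZeroSet

variable {E : Type*} [NormedAddCommGroup E] {A : Set E} (hA : ∀ u ∈ A, -u ∈ A)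

theorem continuous_negOn : Continuous (negOn hA) :=
  (continuous_neg.comp continuous_subtype_val).subtype_mk _

/-- Away from the zeros of an odd function `h`, the classifying map factors through a sphere by
choosing in each orbit the point where `h` is positive. So the restriction of `f^* μ` to this set
is zero. -/
theorem exists_vanishesNear_of_odd (hAc : IsCompact A) (h : E → ℝ) (hc : Continuous h)
    (hodd : ∀ u, h (-u) = -h u) (F : C(A, InfSphere)) (hF : ∀ u, F (negOn hA u) = antipode (F u))
    (μ : H RPInf 1) :
    ∃ φ : cocycles (OrbitSpace (negOn hA) (negOn_involutive hA)) 1,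
      mk φ = pullback (classifyingMap _ (negOn_involutive hA) F hF) 1 μ ∧
      ∀ u : A, h u ≠ 0 → VanishesNear φ.1 (Quotient.mk _ u) := by
  have : CompactSpace A := isCompact_iff_compactSpace.1 hAc
  obtain ⟨m, hm⟩ := exists_skeleton_of_isCompact (isCompact_range F.continuous)
  let F' : A → Skeleton m := fun u => toSkeleton m (F u) (hm _ ⟨u, rfl⟩)
  have hF' : Continuous F' :=
    continuous_toSkeleton (fun i => (continuous_coord i).comp F.continuous) _
  let s : A → A := fun u => if 0 < h u then u else negOn hA u
  have hs : ∀ u, s u = u ∨ s u = negOn hA u := fun u => ite_eq_or_eq _ _ _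
  have hneg : ∀ u, h (negOn hA u) = -h u := fun u => hodd u
  have hs_neg : ∀ u : A, h u ≠ 0 → s (negOn hA u) = s u := by
    intro u hu
    simp only [s, hneg, neg_pos]
    rcases lt_or_gt_of_ne hu with h1 | h1
    · rw [if_pos h1, if_neg h1.not_gt]
    · rw [if_neg h1.not_gt, if_pos h1]
      exact negOn_involutive hA u
  have hhA : Continuous fun u : A => h u := hc.comp continuous_subtype_val
  have hs_cont : ∀ u : A, h u ≠ 0 → ContinuousAt s u := by
    intro u hu
    rcases lt_or_gt_of_ne hu with h1 | h1
    · refine (continuous_negOn hA).continuousAt.congr ?_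
      filter_upwards [hhA.continuousAt (Iio_mem_nhds h1)] with v hv
      exact (if_neg (not_lt.2 (le_of_lt hv))).symm
    · refine continuousAt_id.congr ?_
      filter_upwards [hhA.continuousAt (Ioi_mem_nhds h1)] with v hv
      exact (if_pos hv).symm
  let G : OrbitSpace (negOn hA) (negOn_involutive hA) → Skeleton m := fun p => F' (s p.out)
  obtain ⟨φ, hφ, hv⟩ := exists_vanishesNear_of_factor
    (classifyingMap _ (negOn_involutive hA) F hF) (skeletonToRP m) G (by
      intro p
      have : Quotient.mk (orbitSetoid _ (negOn_involutive hA)) (s p.out) = p := by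
        conv_rhs => rw [← p.out_eq]
        rcases hs p.out with e | e <;> rw [e]
        exact Quotient.sound (Or.inr (negOn_involutive hA _).symm)
      conv_lhs => rw [← this]
      rfl) μ (pullback_skeletonToRP m μ)
  refine ⟨φ, hφ, fun u hu => hv _ ?_⟩
  have hGu : G (Quotient.mk _ u) = F' (s u) := by
    change F' (s (Quotient.mk (orbitSetoid _ (negOn_involutive hA)) u).out) = _
    rcases out_mk_eq_or (negOn_involutive hA) u with e | e <;> rw [e]
    rw [hs_neg u hu]
  have h1 : ∀ v : A, h v ≠ 0 → Filter.Tendsto (fun v => F' (s v)) (𝓝 v) (𝓝 (F' (s v))) :=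
    fun v hv => hF'.continuousAt.comp (hs_cont v hv)
  rw [ContinuousAt, hGu]
  refine tendsto_comp_out (f := fun v => F' (s v)) _ (continuous_negOn hA) (h1 u hu) ?_
  rw [← hs_neg u hu]
  exact h1 _ (by rwa [hneg, neg_ne_zero])

variable {B : Set E} (hB : ∀ u ∈ B, -u ∈ B) (hBA : B ⊆ A)

/-- The map of orbit spaces induced by an inclusion `B ⊆ A` of symmetric sets. -/
def orbitInclusion : C(OrbitSpace (negOn hB) (negOn_involutive hB),
    OrbitSpace (negOn hA) (negOn_involutive hA)) where
  toFun := Quotient.map (Set.inclusion hBA) (by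
    rintro x y (rfl | rfl)
    · exact Or.inl rfl
    · exact Or.inr rfl)
  continuous_toFun := (continuous_inclusion hBA).quotient_map' _

/-- The nearest point projection to a compact set, which need not be continuous, defines a
retraction of orbit spaces which is continuous along the smaller one. -/
theorem exists_orbitRetraction (hBc : IsCompact B) (hne : B.Nonempty) :
    ∃ r : OrbitSpace (negOn hA) (negOn_involutive hA) →
        OrbitSpace (negOn hB) (negOn_involutive hB),
      ∀ y, Filter.Tendsto r (𝓝 (orbitInclusion hA hB hBA y)) (𝓝 y) := by
  have hex : ∀ a : A, ∃ b : B, Metric.infDist (a : E) B = dist (a : E) b := fun a => by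
    obtain ⟨b, hb, e⟩ := hBc.exists_infDist_eq_dist hne (a : E)
    exact ⟨⟨b, hb⟩, e⟩
  choose ρ hρ using hex
  have hρt : ∀ b : B, Filter.Tendsto ρ (𝓝 (Set.inclusion hBA b)) (𝓝 b) := by
    intro b
    rw [Metric.tendsto_nhds_nhds]
    intro ε hε
    refine ⟨ε / 2, half_pos hε, fun {a} ha => ?_⟩
    have h1 : dist (a : E) b < ε / 2 := ha
    have h2 : dist (a : E) (ρ a) ≤ dist (a : E) b :=
      (hρ a).symm.trans_le (Metric.infDist_le_dist_of_mem b.2)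
    have h3 := dist_triangle_left ((ρ a : B) : E) (b : E) (a : E)
    change dist ((ρ a : B) : E) b < ε
    linarith
  refine ⟨fun p => Quotient.mk _ (ρ p.out), fun y => ?_⟩
  induction y using Quotient.ind with | _ b => ?_
  have hq : Continuous (Quotient.mk (orbitSetoid _ (negOn_involutive hB))) :=
    continuous_quotient_mk'
  refine tendsto_comp_out (f := fun a => Quotient.mk (orbitSetoid _ (negOn_involutive hB)) (ρ a))
    (negOn_involutive hA) (continuous_negOn hA) (x := Set.inclusion hBA b)
    ((hq.tendsto b).comp (hρt b)) ?_
  have e : Quotient.mk (orbitSetoid _ (negOn_involutive hB)) b =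
      Quotient.mk (orbitSetoid _ (negOn_involutive hB)) (negOn hB b) := Quotient.sound (Or.inr rfl)
  rw [e]
  exact (hq.tendsto (negOn hB b)).comp (hρt (negOn hB b))

/-- The zero set of an odd function on a compact symmetric set has index at least one less. -/
theorem le_index_zeroSet (hAc : IsCompact A) (h : E → ℝ) (hc : Continuous h)
    (hodd : ∀ u, h (-u) = -h u) (hBeq : B = {u ∈ A | h u = 0}) (N : ℕ)
    (hN : ((N + 1 : ℕ) : ℕ∞) ≤ index (negOn hA) (negOn_involutive hA)) :
    (N : ℕ∞) ≤ index (negOn hB) (negOn_involutive hB) := by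
  have hBA : B ⊆ A := by rw [hBeq]; exact fun u hu => hu.1
  have hBc : IsCompact B := by
    rw [hBeq]
    exact hAc.inter_right (isClosed_singleton.preimage hc)
  have hlt : (N : ℕ∞) < index (negOn hA) (negOn_involutive hA) :=
    lt_of_lt_of_le (by exact_mod_cast Nat.lt_succ_self N) hN
  obtain ⟨_, ⟨k, rfl, F, hF, μ, hμ, hpow⟩, hNk⟩ := lt_sSup_iff.1 hlt
  cases k with
  -- Here `N = 0`, and nothing is claimed about `B`, which may be empty.
  | zero =>
    have : N = 0 := by
      have : N < 0 + 1 := by exact_mod_cast hNk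
      omega
    subst this
    exact bot_le
  | succ j =>
  have hNj : N ≤ j + 1 := by
    have : N < j + 1 + 1 := by exact_mod_cast hNk
    omega
  -- The restriction of `F` to `B` shows that `ind B ≥ j + 1`, unless `w ^ (j + 1) = 0`.
  refine le_trans (b := ((j : ℕ∞) + 1)) (by exact_mod_cast hNj) (le_sSup ?_)
  refine ⟨j, rfl, F.comp ⟨_, continuous_inclusion hBA⟩,
    fun u => hF (Set.inclusion hBA u), μ, hμ, fun hzero => hpow ?_⟩
  set f := classifyingMap _ (negOn_involutive hA) F hF with hf
  have hfact : classifyingMap _ (negOn_involutive hB) (F.comp ⟨_, continuous_inclusion hBA⟩)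
      (fun u => hF (Set.inclusion hBA u)) = f.comp (orbitInclusion hA hB hBA) := by
    ext y
    induction y using Quotient.ind
    rfl
  rw [hfact, pullback_comp, pullback_pow] at hzero
  rw [pullback_pow, pow]
  obtain ⟨P, hP, P', hPP', hP'⟩ : ∃ P : cocycles _ j, mk P = pow (pullback f 1 μ) j ∧
      ∃ P' : Cochain _ j, P.1 - P' ∈ coboundaries _ j ∧
        ∀ y, VanishesNear P' (orbitInclusion hA hB hBA y) := by
    -- If `B` is empty there is no retraction, but then nothing has to vanish.
    rcases B.eq_empty_or_nonempty with hBe | hne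
    · obtain ⟨P, hP⟩ := QuotientAddGroup.mk_surjective (pow (pullback f 1 μ) j)
      refine ⟨P, hP, P.1, by rw [sub_self]; exact zero_mem _, fun y => ?_⟩
      induction y using Quotient.ind with | _ b => ?_
      exact (Set.eq_empty_iff_forall_notMem.1 hBe b b.2).elim
    · obtain ⟨r, hr⟩ := exists_orbitRetraction hA hB hBA hBc hne
      exact exists_vanishesNear_of_pullback_pow_eq_zero _ r hr _ _ hzero
  obtain ⟨φ, hφ, hv⟩ := exists_vanishesNear_of_odd hA hAc h hc hodd F hF μ
  rw [← hP, ← hφ]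
  refine cup_eq_zero_of_vanishesNear P φ hPP' fun x => ?_
  induction x using Quotient.ind with | _ u => ?_
  by_cases hu : h u = 0
  · exact Or.inl (hP' (Quotient.mk _ ⟨u, by rw [hBeq]; exact ⟨u.2, hu⟩⟩))
  · exact Or.inr (hv u hu)

theorem zeroSet_mem_compactSymmetric {N : ℕ} (hA : A ∈ compactSymmetric E (N + 1)) (h : E → ℝ)
    (hc : Continuous h) (hodd : ∀ u, h (-u) = -h u) :
    {u ∈ A | h u = 0} ∈ compactSymmetric E N := by
  obtain ⟨hA0, hAc, hneg, hN⟩ := hA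
  refine ⟨fun u hu => hA0 hu.1, hAc.inter_right (isClosed_singleton.preimage hc),
    fun u hu => ⟨hneg u hu.1, by rw [hodd, hu.2, neg_zero]⟩, ?_⟩
  exact le_index_zeroSet hneg _ hAc h hc hodd rfl N hN

end ZeroSet

end Z2Index

/-! ### Comparison of the min-max values -/

namespace AllenCahn

section Mean

variable {d : ℕ} {M : Type*} [TopologicalSpace M] [ChartedSpace (EuclideanSpace ℝ (Fin d)) M]
  [IsManifold (𝓡 d) ∞ M] [RiemannianBundle (fun x : M => TangentSpace (𝓡 d) x)]
  [IsContMDiffRiemannianBundle (𝓡 d) ∞ (EuclideanSpace ℝ (Fin d))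
    (fun x : M => TangentSpace (𝓡 d) x)]
  [T2Space M] [CompactSpace M] [MeasurableSpace M] [BorelSpace M]

theorem W12.mean_eq_inner (u : W12 d M) : W12.mean u =
    inner ℝ (indicatorConstLp 2 MeasurableSet.univ (measure_ne_top (riemVolume d M) Set.univ)
      (1 : ℝ)) (W12.toL2 u) := by
  rw [L2.inner_indicatorConstLp_one, Measure.restrict_univ, W12.mean]

theorem W12.continuous_mean : Continuous (W12.mean : W12 d M → ℝ) := by
  simp only [funext W12.mean_eq_inner]
  exact continuous_const.inner W12.toL2.continuous

theorem W12.mean_neg (u : W12 d M) : W12.mean (-u) = -W12.mean u := by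
  rw [W12.mean_eq_inner, W12.mean_eq_inner, map_neg, inner_neg_right]

/-- The functions of mean zero in a member of `𝓕_{p+1}` form a member of `𝓖_p`. -/
theorem mean_zero_mem_familyG {p : ℕ} {A : Set (W12 d M)} (hA : A ∈ familyF d M (p + 1)) :
    {u ∈ A | W12.mean u = 0} ∈ familyG d M p :=
  ⟨Z2Index.zeroSet_mem_compactSymmetric hA _ W12.continuous_mean W12.mean_neg, fun _ hu => hu.2⟩

theorem cTildeEps_le_cEps_succ (W : ℝ → ℝ) (ε : ℝ) (p : ℕ) :
    cTildeEps d M W ε p ≤ cEps d M W ε (p + 1) := by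
  refine mul_le_mul_right (le_iInf₂ fun A hA => ?_) _
  exact iInf₂_le_of_le _ (mean_zero_mem_familyG hA) (biSup_mono fun u hu => hu.1)

end Mean

end AllenCahn

end

/-- On a closed Riemannian manifold of dimension `n + 1`, the phase transition half-volume spectrum
satisfies `c̃(p) ≤ c(p + 1)` for all `p`. -/
theorem mainTheorem7 (n : ℕ) (M : Type*) [TopologicalSpace M]
    [ChartedSpace (EuclideanSpace ℝ (Fin (n + 1))) M] [IsManifold (𝓡 (n + 1)) ∞ M]
    [T2Space M] [CompactSpace M] [MeasurableSpace M] [BorelSpace M]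
    [Bundle.RiemannianBundle (fun x : M => TangentSpace (𝓡 (n + 1)) x)]
    [IsContMDiffRiemannianBundle (𝓡 (n + 1)) ∞ (EuclideanSpace ℝ (Fin (n + 1)))
      (fun x : M => TangentSpace (𝓡 (n + 1)) x)]
    (W : ℝ → ℝ) (hW : AllenCahn.IsDoubleWell W) (p : ℕ) :
    AllenCahn.cTilde (n + 1) M W p ≤ AllenCahn.c (n + 1) M W (p + 1) :=
  Filter.liminf_le_liminf (Filter.Eventually.of_forall fun ε =>
    AllenCahn.cTildeEps_le_cEps_succ W ε p)
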